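/- Let $(M,\eta)$ be a smooth pseudo-Riemannian manifold of dimension $m$ with Levi-Civita connection $\bar\nabla$, and let $\Sigma$ be an $n$-dimensional (immersed, Hausdorff) submanifold of $M$ whose induced metric $g$ is nondegenerate. Let $x^1,\dots,x^m$ be local coordinates on $M$, with metric components $\eta_{ij}$ and Christoffel symbols $\bar\Gamma^i_{jk}$; let $u^1,\dots,u^n$ be local coordinates on $\Sigma$, $\partial_a=\partial/\partial u^a$, and $(g^{ab})$ the inverse of $g_{ab}=\eta_{ij}(\partial_a x^i)(\partial_b x^j)$. Repeated indices are summed. Let $N\ge 0$ and let $\{\cdot,\dots,\cdot\}:C^\infty(\Sigma)^{N+1}\to C^\infty(\Sigma)$ be an $\mathbb R$-multilinear map satisfying the Leibniz rule in each argument (no antisymmetry is assumed). Its value at a point depends only on the germs of its arguments there, so it may be applied to the coordinate functions $x^i$ restricted to $\Sigma$. For multi-indices $I=(i_1,\dots,i_N)$, $J=(j_1,\dots,j_N)$ put $\{f,\vec x^I\}=\{f,x^{i_1},\dots,x^{i_N}\}$, $\eta_{IJ}=\eta_{i_1j_1}\cdots\eta_{i_Nj_N}$ and $\mathcal P^{iI}=\frac{1}{\sqrt{N!}}\{x^i,\vec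 x^I\}$. Assume that there are $0<\gamma\in C^\infty(\Sigma)$ and $\epsilon\in\{-1,1\}$ such that, on the part of $\Sigma$ lying in the coordinate domain, $$\mathcal P^{iI}\mathcal P^{jJ}\eta_{IJ}=\epsilon\gamma^2 g^{ab}(\partial_a x^i)(\partial_b x^j)\qquad(1\le i,j\le m).$$ For a smooth function $f$ on $\Sigma$ put $$\mathcal D^i(f)=\frac{\epsilon}{\gamma^2N!}\{x^i,\vec x^I\}\{f,\vec x^J\}\eta_{IJ},\qquad \mathcal D_j(f)=\eta_{ji}\mathcal D^i(f),\qquad {\mathcal D_j}^l=\mathcal D_j(x^l).$$ The operator $\hat\nabla$ (that is, $\hat\nabla_XV=\bar\nabla_{\mathcal D(X)}V$ with $\mathcal D$ the orthogonal projection onto $T\Sigma$) is given, on vector fields $V$ of $M$ along $\Sigma$ and on tensor fields ${T_j}^k$ of type $(1,1)$ along $\Sigma$, by $$\hat\nabla_jV^k=\mathcal D_j(V^k)+{\mathcal D_j}^l\bar\Gamma^k_{lr}V^r,\qquad \hat\nabla_i{T_j}^k=\mathcal D_i({T_j}^k)+{\mathcal D_i}^l\bar\Gamma^k_{lr}{T_j}^r-{\mathcal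 D_i}^l\bar\Gamma^r_{lj}{T_r}^k,$$ and $\hat\nabla_i\hat\nabla_jU^k$ is $\hat\nabla_i$ applied to the tensor field ${T_j}^k=\hat\nabla_jU^k$. Let $\bar R$ be the curvature tensor of $(M,\eta)$, $\bar R(X,Y)=[\bar\nabla_X,\bar\nabla_Y]-\bar\nabla_{[X,Y]}$. Then for every smooth vector field $U$ of $M$ along $\Sigma$ (for instance, the restriction to $\Sigma$ of a vector field on $M$), at every point of $\Sigma$ in the coordinate domain, for all $X,Y$ tangent to $\Sigma$ at that point and all $k$, $$X^iY^j\bigl(\hat\nabla_i\hat\nabla_jU^k-\hat\nabla_j\hat\nabla_iU^k\bigr)=\bigl(\bar R(X,Y)U\bigr)^k .$$ -/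

import Mathlib

open scoped Manifold ContDiff Topology

noncomputable section

namespace BracketGeometry

/-- A smooth pseudo-Riemannian metric on an `m`-dimensional manifold: a smooth field of symmetric
nondegenerate bilinear forms on the tangent spaces. -/
structure PseudoRiemannianMetric (m : ℕ) (M : Type*) [TopologicalSpace M]
    [ChartedSpace (EuclideanSpace ℝ (Fin m)) M] [IsManifold (𝓡 m) ∞ M] where
  /-- The bilinear form on each tangent space. -/
  form (y : M) : TangentSpace (𝓡 m) y →L[ℝ] TangentSpace (𝓡 m) y →L[ℝ] ℝ
  symm (y : M) (v w : TangentSpace (𝓡 m) y) : form y v w = form y w v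
  nondegenerate (y : M) (v : TangentSpace (𝓡 m) y) (hv : ∀ w, form y v w = 0) : v = 0
  contMDiff : ContMDiff (𝓡 m)
    ((𝓡 m).prod 𝓘(ℝ, EuclideanSpace ℝ (Fin m) →L[ℝ] EuclideanSpace ℝ (Fin m) →L[ℝ] ℝ)) ∞
    (fun y : M ↦ Bundle.TotalSpace.mk'
      (EuclideanSpace ℝ (Fin m) →L[ℝ] EuclideanSpace ℝ (Fin m) →L[ℝ] ℝ) y (form y))

/-! ### The ambient manifold in local coordinates

Coordinates on `M` are a chart `φ`; the functions below are defined at points `z` of the coordinate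
space `ℝ^m` and are meaningful for `z ∈ φ.target`. -/

section Ambient

variable {m : ℕ} {M : Type*} [TopologicalSpace M] [ChartedSpace (EuclideanSpace ℝ (Fin m)) M]
  [IsManifold (𝓡 m) ∞ M] (η : PseudoRiemannianMetric m M)
  (φ : OpenPartialHomeomorph M (EuclideanSpace ℝ (Fin m)))

/-- The partial derivative `∂_l F` of a function on `ℝ^m`. -/
def partialDeriv (l : Fin m) (F : EuclideanSpace ℝ (Fin m) → ℝ) (z : EuclideanSpace ℝ (Fin m)) :
    ℝ :=
  fderiv ℝ F z (EuclideanSpace.single l 1)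

/-- The coordinate vector field `∂_i`, at the point of `M` with coordinates `z`. -/
def coordField (i : Fin m) (z : EuclideanSpace ℝ (Fin m)) : TangentSpace (𝓡 m) (φ.symm z) :=
  mfderiv (𝓡 m) (𝓡 m) φ.symm z (EuclideanSpace.single i 1 : EuclideanSpace ℝ (Fin m))

/-- The metric components `η_{ij} = η(∂_i, ∂_j)`. -/
def metricCoeff (i j : Fin m) (z : EuclideanSpace ℝ (Fin m)) : ℝ :=
  η.form (φ.symm z) (coordField φ i z) (coordField φ j z)

/-- The components `η^{ij}` of the inverse metric. -/
def invMetricCoeff (i j : Fin m) (z : EuclideanSpace ℝ (Fin m)) : ℝ :=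
  (Matrix.of fun a b ↦ metricCoeff η φ a b z)⁻¹ i j

/-- The Christoffel symbols `Γ^i_{jk}` of the Levi-Civita connection of `η`;
`christoffel η φ i j k = ½ η^{il} (∂_j η_{lk} + ∂_k η_{lj} - ∂_l η_{jk})`. -/
def christoffel (i j k : Fin m) (z : EuclideanSpace ℝ (Fin m)) : ℝ :=
  (1 / 2) * ∑ l, invMetricCoeff η φ i l z *
    (partialDeriv j (metricCoeff η φ l k) z + partialDeriv k (metricCoeff η φ l j) z
      - partialDeriv l (metricCoeff η φ j k) z)

/-- The components of the curvature tensor of `η`, with `R(X, Y) = [∇_X, ∇_Y] - ∇_{[X, Y]}`: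
`curvature η φ k l i j` is the `k`-th component of `R(∂_i, ∂_j) ∂_l`. -/
def curvature (k l i j : Fin m) (z : EuclideanSpace ℝ (Fin m)) : ℝ :=
  partialDeriv i (christoffel η φ k j l) z - partialDeriv j (christoffel η φ k i l) z
    + ∑ r, (christoffel η φ k i r z * christoffel η φ r j l z
      - christoffel η φ k j r z * christoffel η φ r i l z)

/-- The components of a tangent vector of `M` in the coordinates `φ`. -/
def component (k : Fin m) (y : M) (v : TangentSpace (𝓡 m) y) : ℝ :=
  mvfderiv (𝓡 m) (fun y' : M ↦ φ y' k) y v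

end Ambient

/-! ### Brackets -/

section Bracket

variable {n : ℕ} {S : Type*} [TopologicalSpace S] [ChartedSpace (EuclideanSpace ℝ (Fin n)) S]
  {N : ℕ}

/-- An `(N+1)`-linear bracket on `C^∞(S)` which satisfies the Leibniz rule in each slot. -/
structure Bracket (n : ℕ) (S : Type*) [TopologicalSpace S]
    [ChartedSpace (EuclideanSpace ℝ (Fin n)) S] (N : ℕ) where
  /-- The underlying multilinear map. -/
  toMultilinear : MultilinearMap ℝ (fun _ : Fin (N + 1) ↦ C^∞⟮𝓡 n, S; ℝ⟯) C^∞⟮𝓡 n, S; ℝ⟯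
  leibniz (f : Fin (N + 1) → C^∞⟮𝓡 n, S; ℝ⟯) (k : Fin (N + 1)) (g h : C^∞⟮𝓡 n, S; ℝ⟯) :
    toMultilinear (Function.update f k (g * h)) =
      g * toMultilinear (Function.update f k h) + h * toMultilinear (Function.update f k g)

open Classical in
/-- A globally defined smooth function with the same germ at `q` as `f` (which exists if `S` is
Hausdorff and `f` is smooth near `q`; otherwise `0`). -/
def germExtension (f : S → ℝ) (q : S) : C^∞⟮𝓡 n, S; ℝ⟯ :=
  if h : ∃ F : C^∞⟮𝓡 n, S; ℝ⟯, (F : S → ℝ) =ᶠ[𝓝 q] f then h.choose else 0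

/-- The value at `q` of the bracket of functions that are smooth near `q`, such as the coordinate
functions of `M` restricted to `S`. By the Leibniz rule, the value at `q` depends on the germs of
the functions only, see `Bracket.localValue_coe`. -/
def Bracket.localValue (B : Bracket n S N) (f : Fin (N + 1) → S → ℝ) (q : S) : ℝ :=
  B.toMultilinear (fun k ↦ germExtension (f k) q) q

lemma germExtension_coe (F : C^∞⟮𝓡 n, S; ℝ⟯) (q : S) :
    (germExtension (n := n) (F : S → ℝ) q : S → ℝ) =ᶠ[𝓝 q] F := by
  have h : ∃ G : C^∞⟮𝓡 n, S; ℝ⟯, (G : S → ℝ) =ᶠ[𝓝 q] (F : S → ℝ) :=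
    ⟨F, Filter.EventuallyEq.rfl⟩
  rw [germExtension, dif_pos h]
  exact h.choose_spec

lemma Bracket.update_eq [IsManifold (𝓡 n) ∞ S] [T2Space S] (B : Bracket n S N)
    (f : Fin (N + 1) → C^∞⟮𝓡 n, S; ℝ⟯) (k : Fin (N + 1)) (g h : C^∞⟮𝓡 n, S; ℝ⟯) (q : S)
    (hgh : (g : S → ℝ) =ᶠ[𝓝 q] h) :
    B.toMultilinear (Function.update f k g) q = B.toMultilinear (Function.update f k h) q := by
  obtain ⟨χ, hχ⟩ : ∃ χ : SmoothBumpFunction (𝓡 n) q, tsupport χ ⊆ {x | g x = h x} := by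
    obtain ⟨χ, -, hχ⟩ := (SmoothBumpFunction.nhds_basis_tsupport (I := 𝓡 n) q).mem_iff.1 hgh
    exact ⟨χ, hχ⟩
  let c : C^∞⟮𝓡 n, S; ℝ⟯ := ⟨χ, χ.contMDiff⟩
  have hc : c q = 1 := χ.eq_one
  have hgq : g q = h q := hgh.self_of_nhds
  have hcg : c * g = c * h := by
    ext x
    by_cases hx : x ∈ tsupport χ
    · have hx' : g x = h x := hχ hx
      simp [hx']
    · have hx' : c x = 0 := image_eq_zero_of_notMem_tsupport hx
      simp [hx']
  have key : ∀ u : C^∞⟮𝓡 n, S; ℝ⟯, B.toMultilinear (Function.update f k (c * u)) q =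
      B.toMultilinear (Function.update f k u) q
        + u q * B.toMultilinear (Function.update f k c) q := by
    intro u
    rw [B.leibniz]
    simp [hc]
  have h1 := key g
  rw [hcg, key h, hgq] at h1
  linarith

/-- On globally defined functions, the local values of the bracket are those of the bracket. -/
lemma Bracket.localValue_coe [IsManifold (𝓡 n) ∞ S] [T2Space S] (B : Bracket n S N)
    (F : Fin (N + 1) → C^∞⟮𝓡 n, S; ℝ⟯) (q : S) :
    B.localValue (fun k ↦ (F k : S → ℝ)) q = B.toMultilinear F q := by
  let G : Fin (N + 1) → C^∞⟮𝓡 n, S; ℝ⟯ := fun k ↦ germExtension (F k) q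
  suffices H : ∀ s : Finset (Fin (N + 1)),
      B.toMultilinear (fun k ↦ if k ∈ s then G k else F k) q = B.toMultilinear F q by
    have h := H Finset.univ
    simp only [Finset.mem_univ, if_true] at h
    exact h
  intro s
  induction s using Finset.induction_on with
  | empty => simp
  | insert a s ha ih =>
    rw [← ih]
    have e1 : (fun k ↦ if k ∈ insert a s then G k else F k) =
        Function.update (fun k ↦ if k ∈ s then G k else F k) a (G a) := by
      funext k
      by_cases hk : k = a
      · subst hk; simp
      · simp [hk]
    have e2 : (fun k ↦ if k ∈ s then G k else F k) =
        Function.update (fun k ↦ if k ∈ s then G k else F k) a (F a) := by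
      funext k
      by_cases hk : k = a
      · subst hk; simp [ha]
      · simp [hk]
    rw [e1]
    conv_rhs => rw [e2]
    exact B.update_eq _ _ _ _ _ (germExtension_coe (F a) q)

end Bracket

/-! ### The submanifold and the operator `∇̂` -/

section Submanifold

variable {m n N : ℕ} {M : Type*} [TopologicalSpace M]
  [ChartedSpace (EuclideanSpace ℝ (Fin m)) M] [IsManifold (𝓡 m) ∞ M]
  {S : Type*} [TopologicalSpace S] [ChartedSpace (EuclideanSpace ℝ (Fin n)) S]
  (η : PseudoRiemannianMetric m M)
  (φ : OpenPartialHomeomorph M (EuclideanSpace ℝ (Fin m)))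
  (ι : S → M)

/-- The induced metric `g` on `S`. -/
def inducedMetric (q : S) (v w : TangentSpace (𝓡 n) q) : ℝ :=
  η.form (ι q) (mfderiv (𝓡 n) (𝓡 m) ι q v) (mfderiv (𝓡 n) (𝓡 m) ι q w)

/-- The `a`-th coordinate vector at `q` of the preferred chart of `S` at `q`. -/
def tangentFrame (q : S) (a : Fin n) : TangentSpace (𝓡 n) q :=
  (EuclideanSpace.single a 1 : EuclideanSpace ℝ (Fin n))

/-- The components `g^{ab}` of the inverse of the induced metric. -/
def invInducedCoeff (a b : Fin n) (q : S) : ℝ :=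
  (Matrix.of fun c d ↦ inducedMetric η ι q (tangentFrame q c) (tangentFrame q d))⁻¹ a b

/-- The coordinate functions `x^i` of `M`, restricted to `S`. -/
def coordFun (i : Fin m) (q : S) : ℝ := φ (ι q) i

/-- `∂_a x^i`. -/
def embDeriv (a : Fin n) (i : Fin m) (q : S) : ℝ :=
  mvfderiv (𝓡 n) (coordFun φ ι i) q (tangentFrame q a)

/-- `P(f)^I = (1/√N!) {f, x^{i_1}, …, x^{i_N}}` for a multi-index `I = (i_1, …, i_N)`. In particular
`P(x^i)^I = P^{iI}`. -/
def bracketP (B : Bracket n S N) (f : S → ℝ) (I : Fin N → Fin m) (q : S) : ℝ :=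
  1 / √(N.factorial : ℝ) *
    B.localValue (Fin.cons f fun r ↦ coordFun φ ι (I r)) q

/-- `P(f)^I P(h)^J η_{IJ}`, where `η_{IJ} = η_{i_1 j_1} ⋯ η_{i_N j_N}`. -/
def bracketSquare (B : Bracket n S N) (f h : S → ℝ) (q : S) : ℝ :=
  ∑ I : Fin N → Fin m, ∑ J : Fin N → Fin m,
    bracketP φ ι B f I q * bracketP φ ι B h J q * ∏ r, metricCoeff η φ (I r) (J r) (φ (ι q))

/-- Compatibility of the bracket with the induced metric on the coordinate domain:
`P^{iI} P^{jJ} η_{IJ} = ε γ² g^{ab} (∂_a x^i) (∂_b x^j)`. -/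
def IsCompatible (B : Bracket n S N) (ε : ℝ) (γ : S → ℝ) : Prop :=
  ∀ q : S, ι q ∈ φ.source → ∀ i j : Fin m,
    bracketSquare η φ ι B (coordFun φ ι i) (coordFun φ ι j) q =
      ε * γ q ^ 2 *
        ∑ a : Fin n, ∑ b : Fin n, invInducedCoeff η ι a b q * embDeriv φ ι a i q * embDeriv φ ι b j q

/-- `D^i(f) = (ε/γ²) P^{iI} P(f)^J η_{IJ} = (ε/(γ² N!)) {x^i, x^I} {f, x^J} η_{IJ}`. -/
def dUpper (B : Bracket n S N) (ε : ℝ) (γ : S → ℝ) (i : Fin m) (f : S → ℝ) (q : S) : ℝ :=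
  ε / γ q ^ 2 * bracketSquare η φ ι B (coordFun φ ι i) f q

/-- `D_j(f) = η_{ji} D^i(f)`. -/
def dLower (B : Bracket n S N) (ε : ℝ) (γ : S → ℝ) (j : Fin m) (f : S → ℝ) (q : S) : ℝ :=
  ∑ i, metricCoeff η φ j i (φ (ι q)) * dUpper η φ ι B ε γ i f q

/-- The components `D_j^l = η_{ji} D^{il}` of the projection, where
`D^{il} = D^i(x^l) = (ε/γ²) P^{iI} P^{lJ} η_{IJ}`. -/
def dMixed (B : Bracket n S N) (ε : ℝ) (γ : S → ℝ) (j l : Fin m) (q : S) : ℝ :=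
  dLower η φ ι B ε γ j (coordFun φ ι l) q

/-- The operator `∇̂` on vector fields of `M` along `S`, given by their components `V^k`:
`∇̂_j V^k = D_j(V^k) + D_j^l Γ^k_{lr} V^r`. -/
def hatNabla (B : Bracket n S N) (ε : ℝ) (γ : S → ℝ) (V : Fin m → S → ℝ) (j k : Fin m) (q : S) :
    ℝ :=
  dLower η φ ι B ε γ j (V k) q +
    ∑ l, ∑ r, dMixed η φ ι B ε γ j l q * christoffel η φ k l r (φ (ι q)) * V r q

/-- The operator `∇̂` on tensor fields of type `(1,1)` along `S`, given by their components
`T j k = T_j^k`: `∇̂_i T_j^k = D_i(T_j^k) + D_i^l Γ^k_{lr} T_j^r - D_i^l Γ^r_{lj} T_r^k`. -/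
def hatNablaTensor (B : Bracket n S N) (ε : ℝ) (γ : S → ℝ) (T : Fin m → Fin m → S → ℝ)
    (i j k : Fin m) (q : S) : ℝ :=
  dLower η φ ι B ε γ i (T j k) q +
    ∑ l, ∑ r, dMixed η φ ι B ε γ i l q *
      (christoffel η φ k l r (φ (ι q)) * T j r q - christoffel η φ r l j (φ (ι q)) * T r k q)

/-- `∇̂_i ∇̂_j U^k` for a vector field `U` of `M` along `S`. -/
def hatNablaSq (B : Bracket n S N) (ε : ℝ) (γ : S → ℝ) (U : ∀ q : S, TangentSpace (𝓡 m) (ι q))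
    (i j k : Fin m) (q : S) : ℝ :=
  hatNablaTensor η φ ι B ε γ
    (hatNabla η φ ι B ε γ fun k' q' ↦ component φ k' (ι q') (U q')) i j k q

end Submanifold

end BracketGeometry

end

/-! At each point the bracket is a derivation in its first slot, and point derivations of `C^∞(S)`
are tangent vectors. Hence `D_j` is differentiation along some tangent vector `L_j`. Compatibility
evaluates `D_j(x^l)` and yields `∑_j dx^j(Y) dx^l(L_j) = dx^l(Y)`. The `dx^l` separate tangent
vectors because the induced metric is nondegenerate, so `∑_j dx^j(Y) L_j = Y`
(`exists_dual_tangentVectors`). No explicit formula for `L_j` is needed beyond this duality.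

Consequently `∇̂_j V^k = W^k(L_j)`, where `W^k = dV^k + Γ^k_{lr} V^r dx^l` is the pulled-back
covariant derivative of `V`. Work in a chart of `S` with `X`, `Y` constant, and let `ℓ_j` be the
field `L_j` in that chart. Differentiating the duality relation along `X` gives `∑_j dx^j(Y) X(ℓ_j)
= -∑_j D²x^j(X, Y) ℓ_j`. So `X^i Y^j ∇̂_i ∇̂_j U^k` is `X(W^k(Y)) + Γ^k_{sr} dx^s(X) W^r(Y)` minus
two corrections: one containing `D²x^j(X, Y)`, the other containing `Γ^r_{lj} dx^l(X) dx^j(Y)`. Both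
are symmetric in `X`, `Y`, the second because the connection is torsion-free
(`hatNabla_commutator`).

Antisymmetrizing therefore leaves the curvature of the pulled-back connection
(`pullbackNabla_commutator`), and the chain rule `fderiv_comp_chart` identifies it with the pullback
of the ambient curvature. The remaining work is regularity: the `ℓ_j` must be differentiable, which
rests on the smoothness of local values of the bracket. -/

noncomputable section

namespace BracketGeometry

/-! ### Commutators of pulled-back covariant derivatives on a normed space. -/

section Calculus

variable {E : Type*} [NormedAddCommGroup E] [NormedSpace ℝ E] {m : ℕ}

/-- The pulled-back covariant derivative, as a one-form, of the vector field with components `V`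
along the map with components `x`; `g k l r` are the pulled-back Christoffel symbols. -/
def pullbackNabla (x : Fin m → E → ℝ) (g : Fin m → Fin m → Fin m → E → ℝ) (V : Fin m → E → ℝ)
    (k : Fin m) (u : E) : E →L[ℝ] ℝ :=
  fderiv ℝ (V k) u + ∑ l, ∑ r, (g k l r u * V r u) • fderiv ℝ (x l) u

lemma pullbackNabla_apply (x : Fin m → E → ℝ) (g : Fin m → Fin m → Fin m → E → ℝ)
    (V : Fin m → E → ℝ) (k : Fin m) (u w : E) :
    pullbackNabla x g V k u w =
      fderiv ℝ (V k) u w + ∑ l, ∑ r, fderiv ℝ (x l) u w * g k l r u * V r u := by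
  simp only [pullbackNabla, add_apply, sum_apply,
    smul_apply, smul_eq_mul]
  congr 1
  refine Finset.sum_congr rfl fun l _ ↦ Finset.sum_congr rfl fun r _ ↦ by ring

lemma differentiableAt_fderiv {F : Type*} [NormedAddCommGroup F] [NormedSpace ℝ F]
    {f : E → F} {u : E} (hf : ContDiffAt ℝ 2 f u) :
    DifferentiableAt ℝ (fderiv ℝ f) u :=
  (hf.fderiv_right (m := 1) (by norm_num)).differentiableAt one_ne_zero

lemma fderiv_fderiv_comm {F : Type*} [NormedAddCommGroup F] [NormedSpace ℝ F]
    {f : E → F} {u : E} (hf : ContDiffAt ℝ 2 f u) (X Y : E) :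
    fderiv ℝ (fderiv ℝ f) u X Y = fderiv ℝ (fderiv ℝ f) u Y X :=
  hf.isSymmSndFDerivAt (by simp) X Y

lemma hasFDerivAt_pullbackNabla {x : Fin m → E → ℝ} {g : Fin m → Fin m → Fin m → E → ℝ}
    {V : Fin m → E → ℝ} {u : E} (hx : ∀ l, ContDiffAt ℝ 2 (x l) u)
    (hV : ∀ k, ContDiffAt ℝ 2 (V k) u) (hg : ∀ k l r, DifferentiableAt ℝ (g k l r) u)
    (k : Fin m) :
    HasFDerivAt (pullbackNabla x g V k)
      (fderiv ℝ (fderiv ℝ (V k)) u + ∑ l, ∑ r, ((g k l r u * V r u) • fderiv ℝ (fderiv ℝ (x l)) u +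
        (g k l r u • fderiv ℝ (V r) u + V r u • fderiv ℝ (g k l r) u).smulRight
          (fderiv ℝ (x l) u))) u := by
  have h1 : ∀ l, HasFDerivAt (fderiv ℝ (x l)) (fderiv ℝ (fderiv ℝ (x l)) u) u :=
    fun l ↦ (differentiableAt_fderiv (hx l)).hasFDerivAt
  have h2 : ∀ r, HasFDerivAt (V r) (fderiv ℝ (V r) u) u :=
    fun r ↦ ((hV r).differentiableAt two_ne_zero).hasFDerivAt
  have h3 : ∀ l r, HasFDerivAt (g k l r) (fderiv ℝ (g k l r) u) u :=
    fun l r ↦ (hg k l r).hasFDerivAt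
  exact (differentiableAt_fderiv (hV k)).hasFDerivAt.fun_add
    (HasFDerivAt.fun_sum fun l _ ↦ HasFDerivAt.fun_sum fun r _ ↦ ((h3 l r).mul (h2 r)).smul (h1 l))

/-- The terms are kept in separate sums according to their fate under antisymmetrization: the two
with second derivatives are symmetric in `X`, `Y`, the one with `dV` cancels against the connection
term, and the one with `dΓ` survives into the curvature. -/
lemma fderiv_pullbackNabla_apply {x : Fin m → E → ℝ} {g : Fin m → Fin m → Fin m → E → ℝ}
    {V : Fin m → E → ℝ} {u : E} (hx : ∀ l, ContDiffAt ℝ 2 (x l) u)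
    (hV : ∀ k, ContDiffAt ℝ 2 (V k) u) (hg : ∀ k l r, DifferentiableAt ℝ (g k l r) u)
    (k : Fin m) (X Y : E) :
    fderiv ℝ (pullbackNabla x g V k) u X Y =
      fderiv ℝ (fderiv ℝ (V k)) u X Y +
        ∑ l, ∑ r, g k l r u * V r u * fderiv ℝ (fderiv ℝ (x l)) u X Y +
        ∑ l, ∑ r, fderiv ℝ (x l) u Y * g k l r u * fderiv ℝ (V r) u X +
        ∑ l, ∑ r, fderiv ℝ (x l) u Y * V r u * fderiv ℝ (g k l r) u X := by
  rw [(hasFDerivAt_pullbackNabla hx hV hg k).fderiv]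
  simp only [add_apply, sum_apply,
    smul_apply, ContinuousLinearMap.smulRight_apply, smul_eq_mul]
  rw [add_assoc, add_assoc, ← Finset.sum_add_distrib, ← Finset.sum_add_distrib]
  congr 1
  refine Finset.sum_congr rfl fun l _ ↦ ?_
  rw [← Finset.sum_add_distrib, ← Finset.sum_add_distrib]
  exact Finset.sum_congr rfl fun r _ ↦ by ring

/-- The commutator of pulled-back covariant derivatives. -/
lemma pullbackNabla_commutator {x : Fin m → E → ℝ} {g : Fin m → Fin m → Fin m → E → ℝ}
    {V : Fin m → E → ℝ} {u : E} (hx : ∀ l, ContDiffAt ℝ 2 (x l) u)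
    (hV : ∀ k, ContDiffAt ℝ 2 (V k) u) (hg : ∀ k l r, DifferentiableAt ℝ (g k l r) u)
    (k : Fin m) (X Y : E) :
    (fderiv ℝ (pullbackNabla x g V k) u X Y +
        ∑ s, ∑ r, fderiv ℝ (x s) u X * g k s r u * pullbackNabla x g V r u Y) -
      (fderiv ℝ (pullbackNabla x g V k) u Y X +
        ∑ s, ∑ r, fderiv ℝ (x s) u Y * g k s r u * pullbackNabla x g V r u X) =
    ∑ l, (∑ j, fderiv ℝ (x j) u Y * fderiv ℝ (g k j l) u X -
        ∑ i, fderiv ℝ (x i) u X * fderiv ℝ (g k i l) u Y +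
        ∑ i, ∑ j, (∑ r, (g k i r u * g r j l u - g k j r u * g r i l u)) *
          fderiv ℝ (x i) u X * fderiv ℝ (x j) u Y) * V l u := by
  -- Inserting `W = dV + ΓV dx` into the outer connection term splits it into a `Γ dV` part and the
  -- quadratic `ΓΓV` part of the curvature.
  have key : ∀ X Y : E, ∑ s, ∑ r, fderiv ℝ (x s) u X * g k s r u * pullbackNabla x g V r u Y =
      ∑ l, ∑ r, fderiv ℝ (x l) u X * g k l r u * fderiv ℝ (V r) u Y +
      ∑ l, (∑ i, ∑ j, (∑ r, g k i r u * g r j l u) * fderiv ℝ (x i) u X * fderiv ℝ (x j) u Y)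
        * V l u := by
    intro X Y
    simp only [pullbackNabla_apply, mul_add, Finset.sum_add_distrib, Finset.mul_sum,
      Finset.sum_mul]
    congr 1
    symm
    rw [Finset.sum_comm]
    refine Finset.sum_congr rfl fun i _ ↦ ?_
    rw [Finset.sum_comm]
    refine (Finset.sum_congr rfl fun j _ ↦ Finset.sum_comm).trans ?_
    rw [Finset.sum_comm]
    exact Finset.sum_congr rfl fun r _ ↦ Finset.sum_congr rfl fun j _ ↦
      Finset.sum_congr rfl fun l _ ↦ by ring
  rw [fderiv_pullbackNabla_apply hx hV hg, fderiv_pullbackNabla_apply hx hV hg, key X Y, key Y X,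
    fderiv_fderiv_comm (hV k) X Y]
  simp only [fun l ↦ fderiv_fderiv_comm (hx l) X Y]
  have hC : ∀ X Y : E, ∑ l, ∑ r, fderiv ℝ (x l) u Y * V r u * fderiv ℝ (g k l r) u X =
      ∑ l, (∑ j, fderiv ℝ (x j) u Y * fderiv ℝ (g k j l) u X) * V l u := by
    intro X Y
    rw [Finset.sum_comm]
    refine Finset.sum_congr rfl fun l _ ↦ ?_
    rw [Finset.sum_mul]
    exact Finset.sum_congr rfl fun j _ ↦ by ring
  have hK : ∀ l, ∑ i, ∑ j, (∑ r, g k i r u * g r j l u) * fderiv ℝ (x i) u Y *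
        fderiv ℝ (x j) u X =
      ∑ i, ∑ j, (∑ r, g k j r u * g r i l u) * fderiv ℝ (x i) u X * fderiv ℝ (x j) u Y := by
    intro l
    rw [Finset.sum_comm]
    exact Finset.sum_congr rfl fun i _ ↦ Finset.sum_congr rfl fun j _ ↦ by ring
  rw [hC X Y, hC Y X]
  simp only [hK, Finset.sum_sub_distrib, sub_mul, add_mul, Finset.sum_add_distrib]
  ring

/-- The derivative of `T_j = ⟨W, ℓ_j⟩`, contracted with tangent vectors, when the fields `ℓ_j` are
dual to `x_j`. -/
lemma sum_fderiv_dual_apply {x : Fin m → E → ℝ} {ℓ : Fin m → E → E} {W : E → E →L[ℝ] ℝ} {u : E}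
    (hx : ∀ l, ContDiffAt ℝ 2 (x l) u) (hℓ : ∀ j, DifferentiableAt ℝ (ℓ j) u)
    (hW : DifferentiableAt ℝ W u)
    (hproj : ∀ᶠ u' in 𝓝 u, ∀ w, ∑ j, fderiv ℝ (x j) u' w • ℓ j u' = w) (X Y : E) :
    ∑ j, fderiv ℝ (x j) u Y * fderiv ℝ (fun u' ↦ W u' (ℓ j u')) u X =
      fderiv ℝ W u X Y - ∑ j, fderiv ℝ (fderiv ℝ (x j)) u X Y * W u (ℓ j u) := by
  have hd : ∀ j, fderiv ℝ (fun u' ↦ W u' (ℓ j u')) u X =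
      fderiv ℝ W u X (ℓ j u) + W u (fderiv ℝ (ℓ j) u X) := by
    intro j
    rw [(hW.hasFDerivAt.clm_apply (hℓ j).hasFDerivAt).fderiv]
    simp [add_comm]
  have hc : ∀ j, HasFDerivAt (fun u' ↦ fderiv ℝ (x j) u' Y)
      ((fderiv ℝ (fderiv ℝ (x j)) u).flip Y) u := fun j ↦ by
    have h := (differentiableAt_fderiv (hx j)).hasFDerivAt.clm_apply
      (hasFDerivAt_const (𝕜 := ℝ) Y u)
    simpa using h
  -- The sum is constantly `Y` near `u`, so its derivative, computed here by the product rule,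
  -- vanishes. This trades the derivative of `ℓ_j` for second derivatives of `x_j`.
  have h0 : HasFDerivAt (fun u' ↦ ∑ j, fderiv ℝ (x j) u' Y • ℓ j u')
      (∑ j, (fderiv ℝ (x j) u Y • fderiv ℝ (ℓ j) u +
        ((fderiv ℝ (fderiv ℝ (x j)) u).flip Y).smulRight (ℓ j u))) u :=
    HasFDerivAt.fun_sum fun j _ ↦ (hc j).smul (hℓ j).hasFDerivAt
  have h1 : HasFDerivAt (fun u' ↦ ∑ j, fderiv ℝ (x j) u' Y • ℓ j u') 0 u :=
    (hasFDerivAt_const (𝕜 := ℝ) Y u).congr_of_eventuallyEq (hproj.mono fun u' h ↦ h Y)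
  have h2 := congrArg (fun L ↦ W u (L X)) (h0.unique h1)
  simp only [sum_apply, add_apply, smul_apply, ContinuousLinearMap.smulRight_apply,
    ContinuousLinearMap.flip_apply, map_sum, map_add, map_smul, smul_eq_mul,
    Finset.sum_add_distrib, zero_apply, map_zero] at h2
  simp only [hd, mul_add, Finset.sum_add_distrib]
  have h3 : ∑ j, fderiv ℝ (x j) u Y * fderiv ℝ W u X (ℓ j u) = fderiv ℝ W u X Y := by
    conv_rhs => rw [← hproj.self_of_nhds Y]
    simp
  linarith

/-- The iterated operator `∇̂` in terms of fields `ℓ_j` dual to `x_j`, contracted with two tangent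
vectors and antisymmetrized. -/
lemma hatNabla_commutator {x : Fin m → E → ℝ} {g : Fin m → Fin m → Fin m → E → ℝ}
    {V : Fin m → E → ℝ} {ℓ : Fin m → E → E} {u : E} (hx : ∀ l, ContDiffAt ℝ 2 (x l) u)
    (hV : ∀ k, ContDiffAt ℝ 2 (V k) u) (hg : ∀ k l r, DifferentiableAt ℝ (g k l r) u)
    (hsymm : ∀ k l r, g k l r u = g k r l u) (hℓ : ∀ j, DifferentiableAt ℝ (ℓ j) u)
    (hproj : ∀ᶠ u' in 𝓝 u, ∀ w, ∑ j, fderiv ℝ (x j) u' w • ℓ j u' = w)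
    {T : Fin m → Fin m → E → ℝ}
    (hT : ∀ j k, T j k =ᶠ[𝓝 u] fun u' ↦ pullbackNabla x g V k u' (ℓ j u'))
    {Q : Fin m → Fin m → Fin m → ℝ}
    (hQ : ∀ i j k, Q i j k = fderiv ℝ (T j k) u (ℓ i u) + ∑ l, ∑ r, fderiv ℝ (x l) u (ℓ i u) *
      (g k l r u * T j r u - g r l j u * T r k u))
    (X Y : E) (k : Fin m) :
    ∑ i, ∑ j, fderiv ℝ (x i) u X * fderiv ℝ (x j) u Y * (Q i j k - Q j i k) =
    ∑ l, (∑ j, fderiv ℝ (x j) u Y * fderiv ℝ (g k j l) u X -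
        ∑ i, fderiv ℝ (x i) u X * fderiv ℝ (g k i l) u Y +
        ∑ i, ∑ j, (∑ r, (g k i r u * g r j l u - g k j r u * g r i l u)) *
          fderiv ℝ (x i) u X * fderiv ℝ (x j) u Y) * V l u := by
  have hpr := hproj.self_of_nhds
  have hdual : ∀ (L : E →L[ℝ] ℝ) (w : E), ∑ j, fderiv ℝ (x j) u w * L (ℓ j u) = L w := by
    intro L w
    conv_rhs => rw [← hpr w]
    simp
  have hTu : ∀ j k, T j k u = pullbackNabla x g V k u (ℓ j u) := fun j k ↦ (hT j k).self_of_nhds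
  have hW : DifferentiableAt ℝ (pullbackNabla x g V k) u :=
    (hasFDerivAt_pullbackNabla hx hV hg k).differentiableAt
  -- The first parenthesis is the iterated derivative in the pulled-back connection; the second
  -- collects the corrections, which turn out to be symmetric in `X` and `Y`.
  have key : ∀ X Y : E, ∑ i, ∑ j, fderiv ℝ (x i) u X * fderiv ℝ (x j) u Y * Q i j k =
      (fderiv ℝ (pullbackNabla x g V k) u X Y +
        ∑ s, ∑ r, fderiv ℝ (x s) u X * g k s r u * pullbackNabla x g V r u Y) -
      (∑ j, fderiv ℝ (fderiv ℝ (x j)) u X Y * pullbackNabla x g V k u (ℓ j u) +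
        ∑ j, ∑ l, ∑ r, fderiv ℝ (x l) u X * fderiv ℝ (x j) u Y * g r l j u *
          pullbackNabla x g V k u (ℓ r u)) := by
    intro X Y
    have e1 : ∀ j, ∑ i, fderiv ℝ (x i) u X * Q i j k = fderiv ℝ (T j k) u X +
        ∑ l, ∑ r, fderiv ℝ (x l) u X * (g k l r u * T j r u - g r l j u * T r k u) := by
      intro j
      have := hdual (fderiv ℝ (T j k) u + ∑ l, ∑ r,
        (g k l r u * T j r u - g r l j u * T r k u) • fderiv ℝ (x l) u) X
      simp only [sum_apply, add_apply, smul_apply, smul_eq_mul] at this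
      simpa only [hQ, mul_comm] using this
    have e2 : ∀ j, fderiv ℝ (T j k) u X =
        fderiv ℝ (fun u' ↦ pullbackNabla x g V k u' (ℓ j u')) u X := by
      intro j
      rw [(hT j k).fderiv_eq]
    rw [Finset.sum_comm]
    calc _ = ∑ j, fderiv ℝ (x j) u Y * ∑ i, fderiv ℝ (x i) u X * Q i j k := by
          refine Finset.sum_congr rfl fun j _ ↦ ?_
          rw [Finset.mul_sum]
          exact Finset.sum_congr rfl fun i _ ↦ by ring
      _ = ∑ j, fderiv ℝ (x j) u Y * fderiv ℝ (fun u' ↦ pullbackNabla x g V k u' (ℓ j u')) u X +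
          (∑ l, ∑ r, fderiv ℝ (x l) u X * g k l r u *
            ∑ j, fderiv ℝ (x j) u Y * pullbackNabla x g V r u (ℓ j u)) -
          ∑ j, ∑ l, ∑ r, fderiv ℝ (x l) u X * fderiv ℝ (x j) u Y * g r l j u *
            pullbackNabla x g V k u (ℓ r u) := by
          simp only [e1, e2, hTu, mul_add, Finset.sum_add_distrib, mul_sub,
            Finset.sum_sub_distrib, Finset.mul_sum]
          rw [add_sub_assoc]
          congr 2
          · rw [Finset.sum_comm]
            refine Finset.sum_congr rfl fun l _ ↦ ?_
            rw [Finset.sum_comm]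
            exact Finset.sum_congr rfl fun r _ ↦ Finset.sum_congr rfl fun j _ ↦ by ring
          · exact Finset.sum_congr rfl fun j _ ↦ Finset.sum_congr rfl fun l _ ↦
              Finset.sum_congr rfl fun r _ ↦ by ring
      _ = _ := by
          rw [sum_fderiv_dual_apply hx hℓ hW hproj X Y]
          simp only [hdual]
          ring
  -- Torsion-freeness, through `hsymm`, makes the second correction symmetric in `X` and `Y`.
  have hA : ∑ j, ∑ l, ∑ r, fderiv ℝ (x l) u Y * fderiv ℝ (x j) u X * g r l j u *
          pullbackNabla x g V k u (ℓ r u) =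
      ∑ j, ∑ l, ∑ r, fderiv ℝ (x l) u X * fderiv ℝ (x j) u Y * g r l j u *
          pullbackNabla x g V k u (ℓ r u) := by
    rw [Finset.sum_comm]
    refine Finset.sum_congr rfl fun j _ ↦ Finset.sum_congr rfl fun l _ ↦
      Finset.sum_congr rfl fun r _ ↦ ?_
    rw [hsymm r j l]
    ring
  have hB : ∑ i, ∑ j, fderiv ℝ (x i) u X * fderiv ℝ (x j) u Y * Q j i k =
      ∑ i, ∑ j, fderiv ℝ (x i) u Y * fderiv ℝ (x j) u X * Q i j k := by
    rw [Finset.sum_comm]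
    exact Finset.sum_congr rfl fun j _ ↦ Finset.sum_congr rfl fun l _ ↦ by ring
  rw [← pullbackNabla_commutator hx hV hg k X Y]
  simp only [mul_sub, Finset.sum_sub_distrib]
  rw [hB, key X Y, key Y X, hA]
  simp only [fun l ↦ fderiv_fderiv_comm (hx l) X Y]
  ring

end Calculus

/-! ### Hadamard's lemma with smooth coefficients. -/

section Hadamard

open MeasureTheory

/-- Integrals over the unit interval depend smoothly on parameters. -/
lemma contDiff_integral_unitInterval {P : Type*} [NormedAddCommGroup P] [NormedSpace ℝ P]
    {H : P × ℝ → ℝ} (hH : ContDiff ℝ ∞ H) :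
    ContDiff ℝ ∞ fun p ↦ ∫ t in (0 : ℝ)..1, H (p, t) := by
  -- The integral is the convolution at `0` of the indicator of `(0, 1]` with `s ↦ χ s * H (p, -s)`.
  -- The sign compensates the reflection in the convolution. The cutoff is `1` on `[-2, 2]`, hence
  -- at every `-t` that is integrated over, and makes the second factor compactly supported.
  let χ : ContDiffBump (0 : ℝ) := ⟨2, 3, by norm_num, by norm_num⟩
  let f : ℝ → ℝ := (Set.Ioc (0 : ℝ) 1).indicator 1
  let g : P → ℝ → ℝ := fun p s ↦ χ s * H (p, -s)
  have hf : LocallyIntegrable f volume :=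
    ((integrable_indicator_iff measurableSet_Ioc).2
      (integrableOn_const (C := (1 : ℝ)) (by simp))).locallyIntegrable
  have h := contDiffOn_convolution_right_with_param (n := ⊤) (μ := volume)
    (ContinuousLinearMap.lsmul ℝ ℝ) (g := g) isOpen_univ (isCompact_closedBall (0 : ℝ) 3)
    (fun p s _ hs ↦ by
      have : χ s = 0 := χ.zero_of_le_dist (not_le.1 hs).le
      simp [g, this]) hf
    (by
      refine ContDiff.contDiffOn ?_
      exact (χ.contDiff.comp contDiff_snd).mul
        (hH.comp (contDiff_fst.prodMk contDiff_snd.neg)))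
  rw [Set.univ_prod_univ, contDiffOn_univ] at h
  have h' := h.comp (contDiff_id.prodMk (contDiff_const (c := (0 : ℝ))))
  convert h' using 2 with p
  simp only [Function.comp, convolution, id, f, g]
  rw [intervalIntegral.integral_of_le zero_le_one, ← integral_indicator measurableSet_Ioc]
  refine integral_congr_ae (Filter.Eventually.of_forall fun t ↦ ?_)
  by_cases ht : t ∈ Set.Ioc (0 : ℝ) 1
  · have : χ (-t) = 1 := χ.one_of_mem_closedBall (by
      simp only [Metric.mem_closedBall, dist_zero_right, norm_neg, Real.norm_eq_abs]
      rw [abs_of_pos ht.1]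
      exact ht.2.trans one_le_two)
    simp [ht, this]
  · simp [ht]

/-- Hadamard's lemma. -/
lemma exists_hadamard {n : ℕ} {F : EuclideanSpace ℝ (Fin n) → ℝ} (hF : ContDiff ℝ ∞ F)
    (u₀ : EuclideanSpace ℝ (Fin n)) :
    ∃ G : Fin n → EuclideanSpace ℝ (Fin n) → ℝ, (∀ b, ContDiff ℝ ∞ (G b)) ∧
      (∀ b, G b u₀ = fderiv ℝ F u₀ (EuclideanSpace.single b 1)) ∧
      ∀ u, F u = F u₀ + ∑ b, (u b - u₀ b) * G b u := by
  have hD : ContDiff ℝ ∞ (fderiv ℝ F) := hF.fderiv_right (by simp)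
  have hsm : ∀ b : Fin n, ContDiff ℝ ∞ fun z : EuclideanSpace ℝ (Fin n) × ℝ ↦
      fderiv ℝ F (u₀ + z.2 • (z.1 - u₀)) (EuclideanSpace.single b 1) := fun b ↦
    (hD.comp (contDiff_const.add (contDiff_snd.smul (contDiff_fst.sub contDiff_const)))).clm_apply
      contDiff_const
  refine ⟨fun b u ↦ ∫ t in (0 : ℝ)..1, fderiv ℝ F (u₀ + t • (u - u₀)) (EuclideanSpace.single b 1),
    fun b ↦ contDiff_integral_unitInterval (hsm b), fun b ↦ by simp, fun u ↦ ?_⟩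
  -- Integrating the derivative of `F` along the segment from `u₀` to `u` gives the expansion.
  have hderiv : ∀ t : ℝ, HasDerivAt (fun t : ℝ ↦ F (u₀ + t • (u - u₀)))
      (∑ b, (u b - u₀ b) * fderiv ℝ F (u₀ + t • (u - u₀)) (EuclideanSpace.single b 1)) t := by
    intro t
    have h1 : HasDerivAt (fun t : ℝ ↦ u₀ + t • (u - u₀)) (u - u₀) t := by
      simpa using ((hasDerivAt_id t).smul_const (u - u₀)).const_add u₀
    have h2 := ((hF.differentiable (by simp)).differentiableAt.hasFDerivAt
      (x := u₀ + t • (u - u₀))).comp_hasDerivAt t h1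
    have h3 : u - u₀ = ∑ b, (u b - u₀ b) • EuclideanSpace.single b (1 : ℝ) := by
      ext i
      simp [Finset.sum_apply, Pi.single_apply]
    have h4 := congrArg (fderiv ℝ F (u₀ + t • (u - u₀))) h3
    simp only [map_sum, map_smul, smul_eq_mul] at h4
    rwa [h4] at h2
  have hc : ∀ b : Fin n, Continuous fun t : ℝ ↦
      fderiv ℝ F (u₀ + t • (u - u₀)) (EuclideanSpace.single b 1) := fun b ↦
    (hsm b).continuous.comp (continuous_const.prodMk continuous_id)
  have hc' : ∀ b : Fin n, Continuous fun t : ℝ ↦ (u b - u₀ b) *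
      fderiv ℝ F (u₀ + t • (u - u₀)) (EuclideanSpace.single b 1) := fun b ↦
    continuous_const.mul (hc b)
  have := intervalIntegral.integral_eq_sub_of_hasDerivAt (a := 0) (b := 1) (fun t _ ↦ hderiv t)
    (Continuous.intervalIntegrable (continuous_finsetSum _ fun b _ ↦ hc' b) 0 1)
  rw [intervalIntegral.integral_finsetSum fun b _ ↦
    (hc' b).intervalIntegrable 0 1] at this
  simp only [intervalIntegral.integral_const_mul, one_smul, zero_smul, add_zero,
    add_sub_cancel] at this
  linarith

end Hadamard

/-! ### Germs of smooth functions and local values of the bracket. -/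

section Germs

variable {n : ℕ} {S : Type*} [TopologicalSpace S] [ChartedSpace (EuclideanSpace ℝ (Fin n)) S]
  {N : ℕ}

variable (n) in
/-- `f` is smooth on a neighbourhood of `q`. -/
def SmoothNear (f : S → ℝ) (q : S) : Prop :=
  ∀ᶠ q' in 𝓝 q, ContMDiffAt (𝓡 n) 𝓘(ℝ) ∞ f q'

namespace SmoothNear

variable {f g : S → ℝ} {q : S}

lemma contMDiffAt (h : SmoothNear n f q) : ContMDiffAt (𝓡 n) 𝓘(ℝ) ∞ f q :=
  h.self_of_nhds

lemma eventually (h : SmoothNear n f q) : ∀ᶠ q' in 𝓝 q, SmoothNear n f q' :=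
  eventually_eventually_nhds.2 h

lemma congr (h : SmoothNear n f q) (hfg : f =ᶠ[𝓝 q] g) : SmoothNear n g q := by
  filter_upwards [h, hfg.eventuallyEq_nhds] with q' h1 h2
  exact h1.congr_of_eventuallyEq h2.symm

lemma const (c : ℝ) : SmoothNear n (fun _ : S ↦ c) q :=
  Filter.Eventually.of_forall fun _ ↦ contMDiffAt_const

lemma coe (F : C^∞⟮𝓡 n, S; ℝ⟯) : SmoothNear n F q :=
  Filter.Eventually.of_forall fun q' ↦ F.contMDiff q'

lemma add (hf : SmoothNear n f q) (hg : SmoothNear n g q) :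
    SmoothNear n (fun x ↦ f x + g x) q :=
  (Filter.Eventually.and hf hg).mono fun _ h ↦ h.1.add h.2

lemma mul (hf : SmoothNear n f q) (hg : SmoothNear n g q) :
    SmoothNear n (fun x ↦ f x * g x) q :=
  (Filter.Eventually.and hf hg).mono fun _ h ↦ h.1.mul h.2

lemma sum {α : Type*} {s : Finset α} {f : α → S → ℝ} (hf : ∀ i ∈ s, SmoothNear n (f i) q) :
    SmoothNear n (fun x ↦ ∑ i ∈ s, f i x) q :=
  ((Filter.eventually_all_finset s).2 hf).mono fun _ h ↦ contMDiffAt_finsetSum h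

lemma prod {α : Type*} {s : Finset α} {f : α → S → ℝ} (hf : ∀ i ∈ s, SmoothNear n (f i) q) :
    SmoothNear n (fun x ↦ ∏ i ∈ s, f i x) q :=
  ((Filter.eventually_all_finset s).2 hf).mono fun _ h ↦ contMDiffAt_finsetProd h

variable [IsManifold (𝓡 n) ∞ S] [T2Space S]

/-- A function which is smooth near `q` has a globally smooth representative of its germ. -/
lemma exists_extension (h : SmoothNear n f q) : ∃ F : C^∞⟮𝓡 n, S; ℝ⟯, (F : S → ℝ) =ᶠ[𝓝 q] f := by
  obtain ⟨χ, -, hχ⟩ := (SmoothBumpFunction.nhds_basis_tsupport (I := 𝓡 n) q).mem_iff.1 h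
  refine ⟨⟨fun x ↦ χ x * f x, contMDiff_of_tsupport fun x hx ↦ ?_⟩, ?_⟩
  · exact (χ.contMDiff x).mul (hχ (tsupport_mul_subset_left hx))
  · filter_upwards [χ.eventuallyEq_one] with x hx
    simp [hx]

lemma germExtension_eventuallyEq (h : SmoothNear n f q) :
    (germExtension (n := n) f q : S → ℝ) =ᶠ[𝓝 q] f := by
  rw [germExtension, dif_pos h.exists_extension]
  exact h.exists_extension.choose_spec

end SmoothNear

open Classical in
lemma germExtension_congr {f g : S → ℝ} {q : S} (h : f =ᶠ[𝓝 q] g) :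
    germExtension (n := n) f q = germExtension g q := by
  have : (fun F : C^∞⟮𝓡 n, S; ℝ⟯ ↦ (F : S → ℝ) =ᶠ[𝓝 q] f) =
      fun F : C^∞⟮𝓡 n, S; ℝ⟯ ↦ (F : S → ℝ) =ᶠ[𝓝 q] g := by
    funext F
    exact propext ⟨fun hF ↦ hF.trans h, fun hF ↦ hF.trans h.symm⟩
  -- Both extensions are choices from a predicate. Generalizing the predicate to a variable lets the
  -- equality of predicates be substituted inside the dependent `if`.
  have key : ∀ P : C^∞⟮𝓡 n, S; ℝ⟯ → Prop, (P = fun F : C^∞⟮𝓡 n, S; ℝ⟯ ↦ (F : S → ℝ) =ᶠ[𝓝 q] g) →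
      (if h : ∃ F, P F then h.choose else 0) = germExtension (n := n) g q := by
    rintro _ rfl
    rfl
  exact key _ this

variable [IsManifold (𝓡 n) ∞ S] [T2Space S] (B : Bracket n S N)

/-- `localValue` chooses fresh extensions at every point. The extensions chosen at `q` still have
the right germs at all nearby points, so one global bracket computes the local values there; this is
where their smoothness comes from. -/
lemma Bracket.localValue_eventuallyEq {f : Fin (N + 1) → S → ℝ} {q : S}
    (hf : ∀ k, SmoothNear n (f k) q) :
    B.localValue f =ᶠ[𝓝 q] B.toMultilinear fun k ↦ germExtension (f k) q := by
  have h : ∀ᶠ q' in 𝓝 q, ∀ k, f k =ᶠ[𝓝 q'] germExtension (n := n) (f k) q :=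
    Filter.eventually_all.2 fun k ↦ (hf k).germExtension_eventuallyEq.symm.eventuallyEq_nhds
  filter_upwards [h] with q' hq'
  rw [← B.localValue_coe]
  simp only [Bracket.localValue, germExtension_congr (hq' _)]

lemma Bracket.smoothNear_localValue {f : Fin (N + 1) → S → ℝ} {q : S}
    (hf : ∀ k, SmoothNear n (f k) q) : SmoothNear n (B.localValue f) q :=
  (SmoothNear.coe _).congr (B.localValue_eventuallyEq hf).symm

end Germs

/-! ### Point derivations are tangent vectors. -/

section Derivations

variable {n : ℕ} {S : Type*} [TopologicalSpace S] [ChartedSpace (EuclideanSpace ℝ (Fin n)) S]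
  {N : ℕ}

lemma mvfderiv_congr {f g : S → ℝ} {q : S} (h : f =ᶠ[𝓝 q] g) :
    mvfderiv (𝓡 n) f q = mvfderiv (𝓡 n) g q := by
  ext v
  change mfderiv (𝓡 n) 𝓘(ℝ) f q v = mfderiv (𝓡 n) 𝓘(ℝ) g q v
  rw [h.mfderiv_eq]
  rfl

lemma mvfderiv_eq_fderiv_extChartAt {f : S → ℝ} {q : S} (hf : MDifferentiableAt (𝓡 n) 𝓘(ℝ) f q) :
    mvfderiv (𝓡 n) f q =
      fderiv ℝ (f ∘ (extChartAt (𝓡 n) q).symm) (extChartAt (𝓡 n) q q) := by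
  rw [hf.mvfderiv, ModelWithCorners.range_eq_univ, fderivWithin_univ]
  rfl

variable [IsManifold (𝓡 n) ∞ S]

lemma SmoothNear.comp_extChartAt {H : EuclideanSpace ℝ (Fin n) → ℝ} (hH : ContDiff ℝ ∞ H)
    (q : S) : SmoothNear n (fun q' ↦ H (extChartAt (𝓡 n) q q')) q := by
  filter_upwards [extChartAt_source_mem_nhds (I := 𝓡 n) q] with q' hq'
  exact hH.contMDiff.contMDiffAt.comp q' (contMDiffAt_extChartAt' (by simpa using hq'))

variable [T2Space S]

/-- A point derivation of `C^∞(S)` depends on germs only. -/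
lemma derivation_congr {q : S} {δ : C^∞⟮𝓡 n, S; ℝ⟯ →ₗ[ℝ] ℝ}
    (hδ : ∀ f g, δ (f * g) = f q * δ g + g q * δ f) {f g : C^∞⟮𝓡 n, S; ℝ⟯}
    (hfg : (f : S → ℝ) =ᶠ[𝓝 q] g) : δ f = δ g := by
  obtain ⟨χ, -, hχ⟩ := (SmoothBumpFunction.nhds_basis_tsupport (I := 𝓡 n) q).mem_iff.1 hfg
  let c : C^∞⟮𝓡 n, S; ℝ⟯ := ⟨χ, χ.contMDiff⟩
  have hc : c q = 1 := χ.eq_one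
  have hcg : c * f = c * g := by
    ext x
    by_cases hx : x ∈ tsupport χ
    · have hx' : f x = g x := hχ hx
      simp [hx']
    · have hx' : c x = 0 := image_eq_zero_of_notMem_tsupport hx
      simp [hx']
  have h1 := hδ c f
  rw [hcg, hδ c g, hc, hfg.self_of_nhds] at h1
  linarith

/-- Point derivations of `C^∞(S)` are tangent vectors. -/
lemma exists_tangentVector_of_derivation {q : S} (δ : C^∞⟮𝓡 n, S; ℝ⟯ →ₗ[ℝ] ℝ)
    (hδ : ∀ f g, δ (f * g) = f q * δ g + g q * δ f) :
    ∃ v : TangentSpace (𝓡 n) q, ∀ f : C^∞⟮𝓡 n, S; ℝ⟯, δ f = mvfderiv (𝓡 n) f q v := by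
  let ψ := extChartAt (𝓡 n) q
  have hδ1 : δ 1 = 0 := by
    have := hδ 1 1
    simp at this
    exact this
  have hδc : ∀ c : ℝ, δ (c • 1) = 0 := fun c ↦ by rw [map_smul, hδ1, smul_zero]
  have hcoord : ∀ b : Fin n, SmoothNear n (fun q' ↦ ψ q' b - ψ q b) q := fun b ↦
    SmoothNear.comp_extChartAt (H := fun u ↦ u b - ψ q b) (by fun_prop) q
  choose A hA using fun b ↦ (hcoord b).exists_extension
  -- The components of `v` are the values of `δ` on global extensions of the centred coordinates
  -- `ψ^b - ψ^b(q)`.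
  let v : EuclideanSpace ℝ (Fin n) := WithLp.toLp 2 fun b ↦ δ (A b)
  refine ⟨v, fun f ↦ ?_⟩
  have hfψ : ∀ u ∈ ψ.target, ContMDiffAt (𝓡 n) 𝓘(ℝ) ∞ (f ∘ ψ.symm) u := fun u hu ↦
    (f.contMDiff _).comp u ((contMDiffOn_extChartAt_symm (I := 𝓡 n) q).contMDiffAt
      ((isOpen_extChartAt_target q).mem_nhds hu))
  have hnear : SmoothNear n (f ∘ ψ.symm) (ψ q) := by
    filter_upwards [extChartAt_target_mem_nhds (I := 𝓡 n) q] with u hu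
    exact hfψ u hu
  obtain ⟨F, hF⟩ := hnear.exists_extension
  obtain ⟨G, hGs, hG0, hG⟩ := exists_hadamard (F.contMDiff.contDiff) (ψ q)
  choose H hH using fun b ↦ (SmoothNear.comp_extChartAt (hGs b) q).exists_extension
  -- Hadamard's expansion read on `S`: near `q`, `f` is its value at `q` plus `∑ A_b H_b`, now with
  -- globally smooth factors to which `δ` applies.
  have hf : (f : S → ℝ) =ᶠ[𝓝 q] ((f q) • (1 : C^∞⟮𝓡 n, S; ℝ⟯) + ∑ b, A b * H b :
      C^∞⟮𝓡 n, S; ℝ⟯) := by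
    have h1 : ∀ᶠ q' in 𝓝 q, F (ψ q') = (f ∘ ψ.symm) (ψ q') :=
      (continuousAt_extChartAt (I := 𝓡 n) q).eventually hF
    have hFq : F (ψ q) = f q := by
      rw [hF.self_of_nhds]
      simp [ψ]
    filter_upwards [h1, extChartAt_source_mem_nhds (I := 𝓡 n) q, Filter.eventually_all.2 hA,
      Filter.eventually_all.2 hH] with q' h1 h2 h3 h4
    have h5 : f q' = F (ψ q') := by
      rw [h1, Function.comp_apply, ψ.left_inv h2]
    rw [h5, hG, hFq]
    simp only [ContMDiffMap.coe_add, Pi.add_apply, ContMDiffMap.coe_smul, Pi.smul_apply,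
      ContMDiffMap.coe_one, Pi.one_apply, smul_eq_mul, mul_one]
    rw [show (∑ b, A b * H b : C^∞⟮𝓡 n, S; ℝ⟯) q' = ∑ b, A b q' * H b q' by
      exact map_sum (ContMDiffMap.evalRingHom q') _ _]
    simp only [h3, h4, ψ]
  have hmd : mvfderiv (𝓡 n) f q v = fderiv ℝ F (ψ q) v := by
    rw [mvfderiv_eq_fderiv_extChartAt ((f.contMDiff q).mdifferentiableAt (by simp))]
    exact congrArg (fun L : EuclideanSpace ℝ (Fin n) →L[ℝ] ℝ ↦ L v) hF.symm.fderiv_eq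
  rw [derivation_congr hδ hf, map_add, hδc, zero_add, map_sum, hmd]
  have hv : v = ∑ b, v b • EuclideanSpace.single b (1 : ℝ) := by
    ext i
    simp [Finset.sum_apply, Pi.single_apply]
  rw [hv, map_sum]
  refine Finset.sum_congr rfl fun b _ ↦ ?_
  -- Since `A_b` vanishes at `q`, Leibniz leaves only `H_b(q) δ(A_b)`, and `H_b(q)` is the partial
  -- derivative.
  have hA0 : A b q = 0 := by
    rw [(hA b).self_of_nhds]
    simp
  have hH0 : H b q = fderiv ℝ F (ψ q) (EuclideanSpace.single b 1) := by
    rw [(hH b).self_of_nhds]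
    exact hG0 b
  rw [hδ, hA0, hH0, map_smul]
  simp [v, mul_comm]

/-- The bracket, as a function of its first slot, is at each point given by a tangent vector. -/
lemma Bracket.exists_tangentVector (B : Bracket n S N) (h : Fin N → S → ℝ) (q : S) :
    ∃ v : TangentSpace (𝓡 n) q, ∀ f : S → ℝ, SmoothNear n f q →
      B.localValue (Fin.cons f h) q = mvfderiv (𝓡 n) f q v := by
  let H : Fin (N + 1) → C^∞⟮𝓡 n, S; ℝ⟯ := Fin.cons 0 fun k ↦ germExtension (h k) q
  let δ : C^∞⟮𝓡 n, S; ℝ⟯ →ₗ[ℝ] ℝ :=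
    { toFun := fun f ↦ B.toMultilinear (Function.update H 0 f) q
      map_add' := fun f g ↦ by simp
      map_smul' := fun c f ↦ by simp }
  obtain ⟨v, hv⟩ := exists_tangentVector_of_derivation (q := q) δ
    (fun f g ↦ by simp [δ, B.leibniz])
  refine ⟨v, fun f hf ↦ ?_⟩
  have h1 : mvfderiv (𝓡 n) f q = mvfderiv (𝓡 n) (germExtension (n := n) f q) q :=
    mvfderiv_congr hf.germExtension_eventuallyEq.symm
  rw [h1, ← hv]
  simp only [Bracket.localValue, δ, LinearMap.coe_mk, AddHom.coe_mk]
  congr 2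
  funext k
  refine Fin.cases ?_ (fun k ↦ ?_) k <;> simp [H]

end Derivations

/-! ### The metric and Christoffel symbols in ambient coordinates. -/

section AmbientLemmas

variable {m : ℕ} {M : Type*} [TopologicalSpace M] [ChartedSpace (EuclideanSpace ℝ (Fin m)) M]
  {φ : OpenPartialHomeomorph M (EuclideanSpace ℝ (Fin m))}

lemma euclidean_eq_sum_single (w : EuclideanSpace ℝ (Fin m)) :
    w = ∑ i, w i • EuclideanSpace.single i (1 : ℝ) := by
  ext i
  simp [Finset.sum_apply, Pi.single_apply]

lemma mdifferentiable_of_mem_maximalAtlas_top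
    (hφ : φ ∈ IsManifold.maximalAtlas (𝓡 m) ∞ M) : φ.MDifferentiable (𝓡 m) (𝓡 m) :=
  ⟨(contMDiffOn_of_mem_maximalAtlas hφ).mdifferentiableOn (by simp),
    (contMDiffOn_symm_of_mem_maximalAtlas hφ).mdifferentiableOn (by simp)⟩

lemma component_eq (hφ : φ ∈ IsManifold.maximalAtlas (𝓡 m) ∞ M) {y : M} (hy : y ∈ φ.source)
    (k : Fin m) (v : TangentSpace (𝓡 m) y) :
    component φ k y v =
      (EuclideanSpace.proj k : EuclideanSpace ℝ (Fin m) →L[ℝ] ℝ) (mfderiv (𝓡 m) (𝓡 m) φ y v) := by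
  have h1 : MDifferentiableAt (𝓡 m) (𝓡 m) φ y :=
    (mdifferentiable_of_mem_maximalAtlas_top hφ).mdifferentiableAt hy
  let p : EuclideanSpace ℝ (Fin m) →L[ℝ] ℝ := EuclideanSpace.proj k
  have h2 : HasMFDerivAt (𝓡 m) 𝓘(ℝ) (fun y' ↦ φ y' k) y (p ∘L mfderiv (𝓡 m) (𝓡 m) φ y) :=
    (p.hasMFDerivAt (x := φ y)).comp y h1.hasMFDerivAt
  change mfderiv (𝓡 m) 𝓘(ℝ) (fun y' ↦ φ y' k) y v = _
  rw [h2.mfderiv]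
  rfl

lemma coordField_expansion (hφ : φ ∈ IsManifold.maximalAtlas (𝓡 m) ∞ M)
    {z : EuclideanSpace ℝ (Fin m)} (hz : z ∈ φ.target) (v : TangentSpace (𝓡 m) (φ.symm z)) :
    v = ∑ i, component φ i (φ.symm z) v • coordField φ i z := by
  have hd := mdifferentiable_of_mem_maximalAtlas_top hφ
  refine hd.mfderiv_injective (φ.map_target hz) ?_
  have h1 : ∀ w : EuclideanSpace ℝ (Fin m), mfderiv (𝓡 m) (𝓡 m) φ (φ.symm z)
      (mfderiv (𝓡 m) (𝓡 m) φ.symm z w) = w := fun w ↦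
    congrArg (fun L : EuclideanSpace ℝ (Fin m) →L[ℝ] EuclideanSpace ℝ (Fin m) ↦ L w)
      (hd.comp_symm_deriv hz)
  rw [map_sum]
  simp only [map_smul, coordField, h1, component_eq hφ (φ.map_target hz)]
  exact euclidean_eq_sum_single
    (mfderiv (𝓡 m) (𝓡 m) φ (φ.symm z) v : EuclideanSpace ℝ (Fin m))

variable [IsManifold (𝓡 m) ∞ M] {η : PseudoRiemannianMetric m M}

lemma form_eq_sum (hφ : φ ∈ IsManifold.maximalAtlas (𝓡 m) ∞ M) {y : M} (hy : y ∈ φ.source)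
    (v w : TangentSpace (𝓡 m) y) :
    η.form y v w = ∑ i, ∑ j, metricCoeff η φ i j (φ y) * component φ i y v * component φ j y w := by
  obtain ⟨z, hz, rfl⟩ : ∃ z ∈ φ.target, φ.symm z = y := ⟨φ y, φ.map_source hy, φ.left_inv hy⟩
  conv_lhs => rw [coordField_expansion hφ hz v, coordField_expansion hφ hz w]
  rw [φ.right_inv hz]
  simp only [map_sum, map_smul, sum_apply, smul_apply, smul_eq_mul, Finset.mul_sum, metricCoeff]
  rw [Finset.sum_comm]
  exact Finset.sum_congr rfl fun i _ ↦ Finset.sum_congr rfl fun j _ ↦ by ring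

lemma metricCoeff_comm (i j : Fin m) : metricCoeff η φ i j = metricCoeff η φ j i :=
  funext fun _ ↦ η.symm _ _ _

lemma christoffel_comm (i j k : Fin m) : christoffel η φ i j k = christoffel η φ i k j := by
  funext z
  simp only [christoffel, metricCoeff_comm j k]
  congr 1
  exact Finset.sum_congr rfl fun l _ ↦ by ring

/-- A null vector of the matrix would be the component vector of a nonzero tangent vector orthogonal
to everything. -/
lemma metricCoeff_det_ne_zero (hφ : φ ∈ IsManifold.maximalAtlas (𝓡 m) ∞ M)
    {z : EuclideanSpace ℝ (Fin m)} (hz : z ∈ φ.target) :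
    (Matrix.of fun a b ↦ metricCoeff η φ a b z).det ≠ 0 := by
  intro h
  obtain ⟨c, hc, hc0⟩ := Matrix.exists_mulVec_eq_zero_iff.2 h
  let v : TangentSpace (𝓡 m) (φ.symm z) :=
    mfderiv (𝓡 m) (𝓡 m) φ.symm z (WithLp.toLp 2 c : EuclideanSpace ℝ (Fin m))
  have hv : ∀ i, component φ i (φ.symm z) v = c i := by
    intro i
    rw [component_eq hφ (φ.map_target hz)]
    have h1 := (mdifferentiable_of_mem_maximalAtlas_top hφ).comp_symm_deriv hz
    exact congrArg (fun L : EuclideanSpace ℝ (Fin m) →L[ℝ] EuclideanSpace ℝ (Fin m) ↦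
      L (WithLp.toLp 2 c : EuclideanSpace ℝ (Fin m)) i) h1
  have hv0 : v = 0 := by
    refine η.nondegenerate _ v fun w ↦ ?_
    rw [η.symm, form_eq_sum hφ (φ.map_target hz), φ.right_inv hz]
    refine Finset.sum_eq_zero fun i _ ↦ ?_
    have h1 := congrFun hc0 i
    simp only [Matrix.mulVec, dotProduct, Matrix.of_apply, Pi.zero_apply] at h1
    calc _ = component φ i (φ.symm z) w * ∑ j, metricCoeff η φ i j z * c j := by
          rw [Finset.mul_sum]
          exact Finset.sum_congr rfl fun j _ ↦ by rw [hv]; ring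
      _ = 0 := by rw [h1, mul_zero]
  refine hc (funext fun i ↦ ?_)
  rw [← hv i, hv0]
  simp [component]

/-- The coordinate fields are images of constant sections under the tangent map of `φ.symm`, hence
smooth into the tangent bundle; pairing them with the smooth bundle section `η.form` preserves
smoothness. -/
lemma contDiffAt_metricCoeff (hφ : φ ∈ IsManifold.maximalAtlas (𝓡 m) ∞ M)
    {z : EuclideanSpace ℝ (Fin m)} (hz : z ∈ φ.target) (i j : Fin m) :
    ContDiffAt ℝ ∞ (metricCoeff η φ i j) z := by
  have hsymm := contMDiffOn_symm_of_mem_maximalAtlas hφ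
  have hfield : ∀ i, ContMDiffAt (𝓡 m) (𝓡 m).tangent ∞
      (fun z ↦ (⟨φ.symm z, coordField φ i z⟩ : TangentBundle (𝓡 m) M)) z := by
    intro i
    have h1 := hsymm.contMDiffOn_tangentMapWithin (m := ∞) le_rfl φ.open_target.uniqueMDiffOn
    have h2 : ContMDiff (𝓡 m) (𝓡 m).tangent ∞ (fun z : EuclideanSpace ℝ (Fin m) ↦
        (⟨z, (EuclideanSpace.single i 1 : EuclideanSpace ℝ (Fin m))⟩ :
          TangentBundle (𝓡 m) (EuclideanSpace ℝ (Fin m)))) :=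
      contMDiff_vectorSpace_iff_contDiff.2 contDiff_const
    have h3 := h1.comp (s := φ.target) h2.contMDiffOn (fun z hz ↦ hz)
    refine (h3.contMDiffAt (φ.open_target.mem_nhds hz)).congr_of_eventuallyEq ?_
    filter_upwards [φ.open_target.mem_nhds hz] with z' hz'
    simp only [Function.comp, tangentMapWithin, coordField,
      mfderivWithin_of_isOpen φ.open_target hz']
  have hform := (η.contMDiff (φ.symm z)).comp z
    (hsymm.contMDiffAt (φ.open_target.mem_nhds hz))
  have h := ContMDiffAt.clm_bundle_apply₂ (F₁ := EuclideanSpace ℝ (Fin m))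
    (F₂ := EuclideanSpace ℝ (Fin m)) (F₃ := ℝ) (E₃ := Bundle.Trivial M ℝ)
    (b := φ.symm) (ψ := fun z ↦ η.form (φ.symm z)) hform (hfield i) (hfield j)
  have h' := (Bundle.contMDiffAt_totalSpace.1 h).2
  exact h'.contDiffAt

lemma contDiffAt_partialDeriv {F : EuclideanSpace ℝ (Fin m) → ℝ} {z : EuclideanSpace ℝ (Fin m)}
    (hF : ContDiffAt ℝ ∞ F z) (l : Fin m) : ContDiffAt ℝ ∞ (partialDeriv l F) z :=
  (hF.fderiv_right (m := ∞) (by simp)).clm_apply contDiffAt_const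

lemma contDiffAt_det {ι E : Type*} [Fintype ι] [DecidableEq ι] [NormedAddCommGroup E]
    [NormedSpace ℝ E] {A : E → Matrix ι ι ℝ} {z : E} (hA : ∀ i j, ContDiffAt ℝ ∞ (fun z ↦ A z i j) z) :
    ContDiffAt ℝ ∞ (fun z ↦ (A z).det) z := by
  simp only [Matrix.det_apply']
  exact ContDiffAt.sum fun σ _ ↦ contDiffAt_const.mul (contDiffAt_prod fun i _ ↦ hA _ _)

lemma contDiffAt_invMetricCoeff (hφ : φ ∈ IsManifold.maximalAtlas (𝓡 m) ∞ M)
    {z : EuclideanSpace ℝ (Fin m)} (hz : z ∈ φ.target) (i j : Fin m) :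
    ContDiffAt ℝ ∞ (invMetricCoeff η φ i j) z := by
  -- Cramer's rule: the inverse entries are quotients of determinants, polynomial in the metric
  -- coefficients.
  have h : invMetricCoeff η φ i j = fun z ↦ ((Matrix.of fun a b ↦ metricCoeff η φ a b z).det)⁻¹ *
      ((Matrix.of fun a b ↦ metricCoeff η φ a b z).updateRow j (Pi.single i 1)).det := by
    funext z
    simp only [invMetricCoeff, Matrix.inv_def, Ring.inverse_eq_inv', Matrix.smul_apply,
      Matrix.adjugate_apply, smul_eq_mul]
  rw [h]
  refine ((contDiffAt_det fun a b ↦ contDiffAt_metricCoeff hφ hz a b).inv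
    (metricCoeff_det_ne_zero hφ hz)).mul (contDiffAt_det fun a b ↦ ?_)
  by_cases hb : a = j
  · subst hb
    simpa using contDiffAt_const
  · simpa [Matrix.updateRow_ne hb] using contDiffAt_metricCoeff hφ hz a b

lemma contDiffAt_christoffel (hφ : φ ∈ IsManifold.maximalAtlas (𝓡 m) ∞ M)
    {z : EuclideanSpace ℝ (Fin m)} (hz : z ∈ φ.target) (i j k : Fin m) :
    ContDiffAt ℝ ∞ (christoffel η φ i j k) z := by
  have h := fun l a b ↦ contDiffAt_partialDeriv (contDiffAt_metricCoeff (η := η) hφ hz a b) l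
  exact contDiffAt_const.mul (ContDiffAt.sum fun l _ ↦
    (contDiffAt_invMetricCoeff hφ hz i l).mul (((h _ _ _).add (h _ _ _)).sub (h _ _ _)))

/-- The components are the fibre part of the tangent map of `φ` applied to the section `U` along
`ι`. -/
lemma smoothNear_component {n : ℕ} {S : Type*} [TopologicalSpace S]
    [ChartedSpace (EuclideanSpace ℝ (Fin n)) S] {ι : S → M}
    (hφ : φ ∈ IsManifold.maximalAtlas (𝓡 m) ∞ M)
    (hι : Continuous ι)
    {U : ∀ q : S, TangentSpace (𝓡 m) (ι q)}
    (hU : ContMDiff (𝓡 n) (𝓡 m).tangent ∞ (fun q ↦ (⟨ι q, U q⟩ : TangentBundle (𝓡 m) M)))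
    {q : S} (hq : ι q ∈ φ.source) (k : Fin m) :
    SmoothNear n (fun q' ↦ component φ k (ι q') (U q')) q := by
  have h1 := (contMDiffOn_of_mem_maximalAtlas hφ).contMDiffOn_tangentMapWithin (m := ∞) le_rfl
    φ.open_source.uniqueMDiffOn
  have h2 := (contMDiff_snd_tangentBundle_modelSpace (EuclideanSpace ℝ (Fin m))
    (𝓡 m) (n := ∞)).comp_contMDiffOn h1
  have h3 := h2.comp (s := ι ⁻¹' φ.source) hU.contMDiffOn (fun q hq ↦ hq)
  let p : EuclideanSpace ℝ (Fin m) →L[ℝ] ℝ := EuclideanSpace.proj k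
  have hopen := φ.open_source.preimage hι
  filter_upwards [hopen.mem_nhds hq] with q' hq'
  have h4 := p.contMDiff.contMDiffAt.comp q' (h3.contMDiffAt (hopen.mem_nhds hq'))
  refine h4.congr_of_eventuallyEq ?_
  filter_upwards [hopen.mem_nhds hq'] with q'' hq''
  rw [component_eq hφ hq'']
  simp only [Function.comp, tangentMapWithin, mfderivWithin_of_isOpen φ.open_source hq'']
  rfl

end AmbientLemmas

/-! ### The induced metric and the operators `D_j` as tangent vectors. -/

section SubmanifoldLemmas

variable {m n N : ℕ} {M : Type*} [TopologicalSpace M]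
  [ChartedSpace (EuclideanSpace ℝ (Fin m)) M]
  {S : Type*} [TopologicalSpace S] [ChartedSpace (EuclideanSpace ℝ (Fin n)) S]
  {φ : OpenPartialHomeomorph M (EuclideanSpace ℝ (Fin m))}
  {ι : S → M} {q : S}

lemma contMDiffAt_chart_comp (hι : ContMDiff (𝓡 n) (𝓡 m) ∞ ι)
    (hφ : φ ∈ IsManifold.maximalAtlas (𝓡 m) ∞ M) (hq : ι q ∈ φ.source) :
    ContMDiffAt (𝓡 n) (𝓡 m) ∞ (fun q' ↦ φ (ι q')) q :=
  ((contMDiffOn_of_mem_maximalAtlas hφ).contMDiffAt (φ.open_source.mem_nhds hq)).comp q (hι q)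

lemma eventually_mem_source (hι : ContMDiff (𝓡 n) (𝓡 m) ∞ ι) (hq : ι q ∈ φ.source) :
    ∀ᶠ q' in 𝓝 q, ι q' ∈ φ.source :=
  (φ.open_source.preimage hι.continuous).mem_nhds hq

lemma smoothNear_chart_comp (hι : ContMDiff (𝓡 n) (𝓡 m) ∞ ι)
    (hφ : φ ∈ IsManifold.maximalAtlas (𝓡 m) ∞ M) (hq : ι q ∈ φ.source)
    {H : EuclideanSpace ℝ (Fin m) → ℝ} (hH : ∀ z ∈ φ.target, ContDiffAt ℝ ∞ H z) :
    SmoothNear n (fun q' ↦ H (φ (ι q'))) q := by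
  filter_upwards [eventually_mem_source hι hq] with q' hq'
  exact (hH _ (φ.map_source hq')).contMDiffAt.comp q' (contMDiffAt_chart_comp hι hφ hq')

lemma smoothNear_coordFun (hι : ContMDiff (𝓡 n) (𝓡 m) ∞ ι)
    (hφ : φ ∈ IsManifold.maximalAtlas (𝓡 m) ∞ M) (hq : ι q ∈ φ.source) (i : Fin m) :
    SmoothNear n (coordFun φ ι i) q :=
  smoothNear_chart_comp (H := fun z ↦ z i) hι hφ hq fun z _ ↦ by fun_prop

lemma mvfderiv_coordFun (hι : ContMDiff (𝓡 n) (𝓡 m) ∞ ι)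
    (hφ : φ ∈ IsManifold.maximalAtlas (𝓡 m) ∞ M) (hq : ι q ∈ φ.source) (i : Fin m)
    (X : TangentSpace (𝓡 n) q) :
    mvfderiv (𝓡 n) (coordFun φ ι i) q X =
      component φ i (ι q) (mfderiv (𝓡 n) (𝓡 m) ι q X) := by
  have h1 : MDifferentiableAt (𝓡 m) (𝓡 m) φ (ι q) :=
    (mdifferentiable_of_mem_maximalAtlas_top hφ).mdifferentiableAt hq
  have h2 : MDifferentiableAt (𝓡 n) (𝓡 m) ι q := (hι q).mdifferentiableAt (by simp)
  let p : EuclideanSpace ℝ (Fin m) →L[ℝ] ℝ := EuclideanSpace.proj i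
  have h3 : HasMFDerivAt (𝓡 n) 𝓘(ℝ) (coordFun φ ι i) q
      (p ∘L (mfderiv (𝓡 m) (𝓡 m) φ (ι q) ∘L mfderiv (𝓡 n) (𝓡 m) ι q)) :=
    (p.hasMFDerivAt (x := φ (ι q))).comp q (h1.hasMFDerivAt.comp q h2.hasMFDerivAt)
  rw [component_eq hφ hq]
  change mfderiv (𝓡 n) 𝓘(ℝ) (coordFun φ ι i) q X = _
  rw [h3.mfderiv]
  rfl

lemma smoothNear_bracketP [IsManifold (𝓡 n) ∞ S] [T2Space S] {B : Bracket n S N}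
    (hι : ContMDiff (𝓡 n) (𝓡 m) ∞ ι)
    (hφ : φ ∈ IsManifold.maximalAtlas (𝓡 m) ∞ M) (hq : ι q ∈ φ.source)
    {f : S → ℝ} (hf : SmoothNear n f q) (I : Fin N → Fin m) :
    SmoothNear n (bracketP φ ι B f I) q :=
  (SmoothNear.const _).mul (B.smoothNear_localValue fun k ↦ by
    refine Fin.cases ?_ (fun r ↦ ?_) k
    · simpa using hf
    · simpa using smoothNear_coordFun hι hφ hq (I r))

variable [IsManifold (𝓡 m) ∞ M] {η : PseudoRiemannianMetric m M}

lemma inducedMetric_eq_sum (hι : ContMDiff (𝓡 n) (𝓡 m) ∞ ι)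
    (hφ : φ ∈ IsManifold.maximalAtlas (𝓡 m) ∞ M) (hq : ι q ∈ φ.source)
    (X Y : TangentSpace (𝓡 n) q) :
    inducedMetric η ι q X Y = ∑ i, ∑ j, metricCoeff η φ i j (φ (ι q)) *
      mvfderiv (𝓡 n) (coordFun φ ι i) q X * mvfderiv (𝓡 n) (coordFun φ ι j) q Y := by
  simp only [mvfderiv_coordFun hι hφ hq]
  exact form_eq_sum hφ hq _ _

lemma eq_zero_of_mvfderiv_coordFun (hι : ContMDiff (𝓡 n) (𝓡 m) ∞ ι)
    (hg : ∀ v : TangentSpace (𝓡 n) q, (∀ w, inducedMetric η ι q v w = 0) → v = 0)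
    (hφ : φ ∈ IsManifold.maximalAtlas (𝓡 m) ∞ M) (hq : ι q ∈ φ.source)
    {v : TangentSpace (𝓡 n) q} (hv : ∀ l, mvfderiv (𝓡 n) (coordFun φ ι l) q v = 0) : v = 0 :=
  hg v fun w ↦ by
    rw [inducedMetric_eq_sum hι hφ hq]
    simp [hv]

lemma tangent_eq_sum (q : S) (Y : TangentSpace (𝓡 n) q) :
    Y = ∑ d, (Y : EuclideanSpace ℝ (Fin n)).ofLp d • tangentFrame q d :=
  euclidean_eq_sum_single (Y : EuclideanSpace ℝ (Fin n))

lemma inducedMetric_sum_left (q : S) (c : Fin n → ℝ) (w : TangentSpace (𝓡 n) q) :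
    inducedMetric η ι q (∑ d, c d • tangentFrame q d) w =
      ∑ d, c d * inducedMetric η ι q (tangentFrame q d) w := by
  simp only [inducedMetric, map_sum, map_smul, sum_apply, smul_apply, smul_eq_mul]

lemma inducedMetric_comm (q : S) (v w : TangentSpace (𝓡 n) q) :
    inducedMetric η ι q v w = inducedMetric η ι q w v :=
  η.symm _ _ _

lemma inducedMetric_det_ne_zero
    (hg : ∀ v : TangentSpace (𝓡 n) q, (∀ w, inducedMetric η ι q v w = 0) → v = 0) :
    (Matrix.of fun c d ↦ inducedMetric η ι q (tangentFrame (n := n) q c) (tangentFrame q d)).det ≠ 0 := by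
  intro h
  obtain ⟨c, hc, hc0⟩ := Matrix.exists_vecMul_eq_zero_iff.2 h
  have h0 : ∑ d, c d • tangentFrame (n := n) q d = 0 := by
    refine hg _ fun w ↦ ?_
    rw [tangent_eq_sum q w, inducedMetric_comm, inducedMetric_sum_left]
    refine Finset.sum_eq_zero fun a _ ↦ ?_
    rw [inducedMetric_comm, inducedMetric_sum_left]
    have := congrFun hc0 a
    simp only [Matrix.vecMul, dotProduct, Matrix.of_apply, Pi.zero_apply] at this
    rw [this, mul_zero]
  have h1 := euclidean_eq_sum_single (WithLp.toLp 2 c)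
  refine hc (funext fun i ↦ ?_)
  have h2 : (WithLp.toLp 2 c : EuclideanSpace ℝ (Fin n)) = 0 := h1.trans h0
  exact congrArg (fun u : EuclideanSpace ℝ (Fin n) ↦ u i) h2

/-- The inverse of the induced metric raises indices. -/
lemma sum_inducedMetric_mul_inv
    (hg : ∀ v : TangentSpace (𝓡 n) q, (∀ w, inducedMetric η ι q v w = 0) → v = 0)
    (L : TangentSpace (𝓡 n) q →L[ℝ] ℝ) (Y : TangentSpace (𝓡 n) q) :
    ∑ a, ∑ b, inducedMetric η ι q Y (tangentFrame q a) * invInducedCoeff η ι a b q *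
      L (tangentFrame q b) = L Y := by
  have hinv := Matrix.mul_nonsing_inv
    (Matrix.of fun c d ↦ inducedMetric η ι q (tangentFrame (n := n) q c) (tangentFrame q d))
    (isUnit_iff_ne_zero.2 (inducedMetric_det_ne_zero hg))
  have hentry : ∀ d b, ∑ a, inducedMetric η ι q (tangentFrame (n := n) q d) (tangentFrame q a) *
      invInducedCoeff η ι a b q = if d = b then 1 else 0 := by
    intro d b
    have := congrFun (congrFun hinv d) b
    rwa [Matrix.mul_apply, Matrix.one_apply] at this
  obtain ⟨c, hc⟩ : ∃ c : Fin n → ℝ, Y = ∑ d, c d • tangentFrame (n := n) q d := ⟨_, tangent_eq_sum q Y⟩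
  rw [hc, map_sum]
  simp only [inducedMetric_sum_left, map_smul, smul_eq_mul]
  rw [Finset.sum_comm]
  refine Finset.sum_congr rfl fun b _ ↦ ?_
  rw [← Finset.sum_mul]
  congr 1
  simp only [Finset.sum_mul]
  rw [Finset.sum_comm]
  simp only [mul_assoc, ← Finset.mul_sum, hentry]
  simp

variable {B : Bracket n S N} {ε : ℝ} {γ : S → ℝ}

/-- The prefactor `ε/γ²` cancels the `εγ²` of the compatibility condition because `ε² = 1`. -/
lemma dLower_coordFun (hε : ε = 1 ∨ ε = -1) (hγ : 0 < γ q) (hB : IsCompatible η φ ι B ε γ)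
    (hq : ι q ∈ φ.source) (j l : Fin m) :
    dLower η φ ι B ε γ j (coordFun φ ι l) q =
      ∑ i, metricCoeff η φ j i (φ (ι q)) * ∑ a : Fin n, ∑ b : Fin n, invInducedCoeff η ι a b q *
        embDeriv φ ι a i q * embDeriv φ ι b l q := by
  simp only [dLower, dUpper]
  refine Finset.sum_congr rfl fun i _ ↦ ?_
  rw [hB q hq i l]
  have hε2 : ε * ε = 1 := by rcases hε with rfl | rfl <;> norm_num
  have hγ0 := hγ.ne'
  congr 1
  rw [← mul_assoc]
  have : ε / γ q ^ 2 * (ε * γ q ^ 2) = 1 := by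
    field_simp
    linarith
  rw [this, one_mul]

/-- The operators `D_j` realise the orthogonal projection, on coordinate functions. -/
lemma sum_mvfderiv_mul_dLower (hι : ContMDiff (𝓡 n) (𝓡 m) ∞ ι)
    (hg : ∀ v : TangentSpace (𝓡 n) q, (∀ w, inducedMetric η ι q v w = 0) → v = 0)
    (hφ : φ ∈ IsManifold.maximalAtlas (𝓡 m) ∞ M)
    (hε : ε = 1 ∨ ε = -1) (hγ : 0 < γ q) (hB : IsCompatible η φ ι B ε γ)
    (hq : ι q ∈ φ.source) (l : Fin m) (Y : TangentSpace (𝓡 n) q) :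
    ∑ j, mvfderiv (𝓡 n) (coordFun φ ι j) q Y * dLower η φ ι B ε γ j (coordFun φ ι l) q =
      mvfderiv (𝓡 n) (coordFun φ ι l) q Y := by
  rw [← sum_inducedMetric_mul_inv hg (mvfderiv (𝓡 n) (coordFun φ ι l) q) Y]
  simp only [dLower_coordFun hε hγ hB hq, inducedMetric_eq_sum hι hφ hq, embDeriv,
    Finset.mul_sum, Finset.sum_mul]
  symm
  calc _ = ∑ a, ∑ j, ∑ i, ∑ b, metricCoeff η φ j i (φ (ι q)) *
          mvfderiv (𝓡 n) (coordFun φ ι j) q Y *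
          mvfderiv (𝓡 n) (coordFun φ ι i) q (tangentFrame q a) * invInducedCoeff η ι a b q *
          mvfderiv (𝓡 n) (coordFun φ ι l) q (tangentFrame q b) := by
        refine Finset.sum_congr rfl fun a _ ↦ ?_
        rw [Finset.sum_comm]
        exact Finset.sum_congr rfl fun j _ ↦ Finset.sum_comm
    _ = _ := by
        rw [Finset.sum_comm]
        refine Finset.sum_congr rfl fun j _ ↦ ?_
        rw [Finset.sum_comm]
        exact Finset.sum_congr rfl fun i _ ↦ Finset.sum_congr rfl fun a _ ↦
          Finset.sum_congr rfl fun b _ ↦ by ring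

variable [IsManifold (𝓡 n) ∞ S] [T2Space S]

/-- At each point the operators `D_j` are given by tangent vectors, which are dual to the
differentials of the coordinate functions. -/
lemma exists_dual_tangentVectors (hι : ContMDiff (𝓡 n) (𝓡 m) ∞ ι)
    (hg : ∀ v : TangentSpace (𝓡 n) q, (∀ w, inducedMetric η ι q v w = 0) → v = 0)
    (hφ : φ ∈ IsManifold.maximalAtlas (𝓡 m) ∞ M)
    (hε : ε = 1 ∨ ε = -1) (hγ : 0 < γ q) (hB : IsCompatible η φ ι B ε γ)
    (hq : ι q ∈ φ.source) :
    ∃ L : Fin m → TangentSpace (𝓡 n) q,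
      (∀ j f, SmoothNear n f q → dLower η φ ι B ε γ j f q = mvfderiv (𝓡 n) f q (L j)) ∧
      ∀ Y, ∑ j, mvfderiv (𝓡 n) (coordFun φ ι j) q Y • L j = Y := by
  choose w hw using fun I : Fin N → Fin m ↦
    B.exists_tangentVector (fun r ↦ coordFun φ ι (I r)) q
  -- For fixed `J`, `{f, x^J}` at `q` is the derivative of `f` along `w J`; `L j` is the combination
  -- of the `w J` with the coefficients from the definition of `D_j`.
  let L : Fin m → TangentSpace (𝓡 n) q := fun j ↦ ∑ i, ∑ I : Fin N → Fin m, ∑ J : Fin N → Fin m,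
    (metricCoeff η φ j i (φ (ι q)) * (ε / γ q ^ 2) * bracketP φ ι B (coordFun φ ι i) I q *
      (1 / √(N.factorial : ℝ)) * ∏ r, metricCoeff η φ (I r) (J r) (φ (ι q))) • w J
  have hL : ∀ j f, SmoothNear n f q →
      dLower η φ ι B ε γ j f q = mvfderiv (𝓡 n) f q (L j) := by
    intro j f hf
    have hP : ∀ J, bracketP φ ι B f J q =
        1 / √(N.factorial : ℝ) * mvfderiv (𝓡 n) f q (w J) := by
      intro J
      rw [bracketP, hw J f hf]
    simp only [L, map_sum, map_smul, smul_eq_mul, dLower, dUpper, bracketSquare, hP,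
      Finset.mul_sum]
    exact Finset.sum_congr rfl fun i _ ↦ Finset.sum_congr rfl fun I _ ↦
      Finset.sum_congr rfl fun J _ ↦ by ring
  refine ⟨L, hL, fun Y ↦ ?_⟩
  rw [← sub_eq_zero]
  -- The `dx^l` separate tangent vectors, so the vector identity need only be tested on coordinate
  -- functions, where compatibility gives it.
  refine eq_zero_of_mvfderiv_coordFun hι hg hφ hq fun l ↦ ?_
  rw [map_sub, map_sum, sub_eq_zero]
  simp only [map_smul, smul_eq_mul, ← hL _ _ (smoothNear_coordFun hι hφ hq l)]
  exact sum_mvfderiv_mul_dLower hι hg hφ hε hγ hB hq l Y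

lemma smoothNear_dLower (hι : ContMDiff (𝓡 n) (𝓡 m) ∞ ι)
    (hφ : φ ∈ IsManifold.maximalAtlas (𝓡 m) ∞ M) (hq : ι q ∈ φ.source)
    (hγ : ∀ q, 0 < γ q) (hγs : ContMDiff (𝓡 n) 𝓘(ℝ) ∞ γ)
    {f : S → ℝ} (hf : SmoothNear n f q) (j : Fin m) :
    SmoothNear n (dLower η φ ι B ε γ j f) q := by
  have hη : ∀ a b, SmoothNear n (fun q' ↦ metricCoeff η φ a b (φ (ι q'))) q := fun a b ↦
    smoothNear_chart_comp hι hφ hq fun _ hz ↦ contDiffAt_metricCoeff hφ hz a b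
  have hc : SmoothNear n (fun q' ↦ ε / γ q' ^ 2) q := Filter.Eventually.of_forall fun q' ↦ by
    have h : ContDiffAt ℝ ∞ (fun t : ℝ ↦ ε / t ^ 2) (γ q') :=
      contDiffAt_const.div (contDiffAt_id.pow 2) (pow_ne_zero 2 (hγ q').ne')
    exact h.contMDiffAt.comp q' (hγs q')
  exact SmoothNear.sum fun i _ ↦ (hη j i).mul (hc.mul (SmoothNear.sum fun I _ ↦
    SmoothNear.sum fun J _ ↦ ((smoothNear_bracketP hι hφ hq
      (smoothNear_coordFun hι hφ hq i) I).mul (smoothNear_bracketP hι hφ hq hf J)).mul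
      (SmoothNear.prod fun r _ ↦ hη _ _)))

lemma smoothNear_hatNabla (hι : ContMDiff (𝓡 n) (𝓡 m) ∞ ι)
    (hφ : φ ∈ IsManifold.maximalAtlas (𝓡 m) ∞ M) (hq : ι q ∈ φ.source)
    (hγ : ∀ q, 0 < γ q) (hγs : ContMDiff (𝓡 n) 𝓘(ℝ) ∞ γ)
    {V : Fin m → S → ℝ} (hV : ∀ k, SmoothNear n (V k) q) (j k : Fin m) :
    SmoothNear n (hatNabla η φ ι B ε γ V j k) q :=
  (smoothNear_dLower hι hφ hq hγ hγs (hV k) j).add (SmoothNear.sum fun l _ ↦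
    SmoothNear.sum fun r _ ↦ ((smoothNear_dLower hι hφ hq hγ hγs
      (smoothNear_coordFun hι hφ hq l) j).mul
      (smoothNear_chart_comp hι hφ hq fun _ hz ↦ contDiffAt_christoffel hφ hz k l r)).mul (hV r))

end SubmanifoldLemmas

/-! ### Derivatives on the submanifold in a fixed chart. -/

section LocalCoordinates

variable {n : ℕ} {S : Type*} [TopologicalSpace S] [ChartedSpace (EuclideanSpace ℝ (Fin n)) S]
  [IsManifold (𝓡 n) ∞ S]

lemma contMDiffAt_comp_extChartAt_symm {E : Type*} [NormedAddCommGroup E] [NormedSpace ℝ E]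
    {q q' : S} (hq' : q' ∈ (extChartAt (𝓡 n) q).source) {f : S → E}
    (hf : ContMDiffAt (𝓡 n) 𝓘(ℝ, E) ∞ f q') :
    ContDiffAt ℝ ∞ (f ∘ (extChartAt (𝓡 n) q).symm) (extChartAt (𝓡 n) q q') := by
  have ht := (extChartAt (𝓡 n) q).map_source hq'
  refine ContMDiffAt.contDiffAt (ContMDiffAt.comp (I' := 𝓡 n) _ ?_
    ((contMDiffOn_extChartAt_symm (I := 𝓡 n) q).contMDiffAt
      ((isOpen_extChartAt_target q).mem_nhds ht)))
  rwa [(extChartAt (𝓡 n) q).left_inv hq']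

/-- Away from the centre of the chart its differential must be kept. This generality is needed
because the duality relation gets differentiated, so it has to hold in one chart on a whole
neighbourhood of `q`. -/
lemma mvfderiv_eq_fderiv_comp_mfderiv {q q' : S} (hq' : q' ∈ (extChartAt (𝓡 n) q).source)
    {f : S → ℝ} (hf : ContMDiffAt (𝓡 n) 𝓘(ℝ) ∞ f q') (v : TangentSpace (𝓡 n) q') :
    mvfderiv (𝓡 n) f q' v = fderiv ℝ (f ∘ (extChartAt (𝓡 n) q).symm) (extChartAt (𝓡 n) q q')
      (mfderiv (𝓡 n) (𝓡 n) (extChartAt (𝓡 n) q) q' v) := by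
  have h1 : f =ᶠ[𝓝 q'] (f ∘ (extChartAt (𝓡 n) q).symm) ∘ extChartAt (𝓡 n) q := by
    filter_upwards [(isOpen_extChartAt_source (I := 𝓡 n) q).mem_nhds hq'] with x hx
    simp only [Function.comp, (extChartAt (𝓡 n) q).left_inv hx]
  have h2 := ((contMDiffAt_comp_extChartAt_symm hq' hf).differentiableAt (by simp)).hasFDerivAt
  have h3 : MDifferentiableAt (𝓡 n) (𝓡 n) (extChartAt (𝓡 n) q) q' :=
    (contMDiffAt_extChartAt' (I := 𝓡 n) (n := ∞) (by simpa using hq')).mdifferentiableAt (by simp)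
  rw [mvfderiv_congr h1]
  change mfderiv (𝓡 n) 𝓘(ℝ) _ q' v = _
  rw [(h2.hasMFDerivAt.comp q' h3.hasMFDerivAt).mfderiv]
  rfl

lemma fderiv_comp_chart {m : ℕ} {M : Type*} [TopologicalSpace M]
    [ChartedSpace (EuclideanSpace ℝ (Fin m)) M]
    {φ : OpenPartialHomeomorph M (EuclideanSpace ℝ (Fin m))} {ι : S → M} {q : S}
    (hι : ContMDiff (𝓡 n) (𝓡 m) ∞ ι)
    (hφ : φ ∈ IsManifold.maximalAtlas (𝓡 m) ∞ M) (hq : ι q ∈ φ.source)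
    {G : EuclideanSpace ℝ (Fin m) → ℝ} (hG : DifferentiableAt ℝ G (φ (ι q)))
    (X : EuclideanSpace ℝ (Fin n)) :
    fderiv ℝ (fun u ↦ G (φ (ι ((extChartAt (𝓡 n) q).symm u)))) (extChartAt (𝓡 n) q q) X =
      ∑ i, partialDeriv i G (φ (ι q)) *
        fderiv ℝ (coordFun φ ι i ∘ (extChartAt (𝓡 n) q).symm) (extChartAt (𝓡 n) q q) X := by
  have hp := ((contMDiffAt_comp_extChartAt_symm (mem_extChartAt_source (I := 𝓡 n) q)
    (contMDiffAt_chart_comp hι hφ hq)).differentiableAt (by simp)).hasFDerivAt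
  set p := (fun q' ↦ φ (ι q')) ∘ (extChartAt (𝓡 n) q).symm with hpdef
  set u := extChartAt (𝓡 n) q q
  have hpu : p u = φ (ι q) := by simp [hpdef, u]
  have hcoord : ∀ i, fderiv ℝ (coordFun φ ι i ∘ (extChartAt (𝓡 n) q).symm) u X =
      (fderiv ℝ p u X).ofLp i := by
    intro i
    have := ((EuclideanSpace.proj i : EuclideanSpace ℝ (Fin m) →L[ℝ] ℝ).hasFDerivAt
      (x := p u)).comp u hp
    exact congrArg (fun L : EuclideanSpace ℝ (Fin n) →L[ℝ] ℝ ↦ L X) this.fderiv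
  rw [← hpu] at hG ⊢
  have h1 := congrArg (fun L : EuclideanSpace ℝ (Fin n) →L[ℝ] ℝ ↦ L X)
    (hG.hasFDerivAt.comp u hp).fderiv
  refine h1.trans ?_
  have h2 := congrArg (fderiv ℝ G (p u)) (euclidean_eq_sum_single (fderiv ℝ p u X))
  rw [map_sum] at h2
  simp only [map_smul, smul_eq_mul, ← hcoord] at h2
  refine h2.trans (Finset.sum_congr rfl fun i _ ↦ ?_)
  rw [mul_comm]
  rfl

end LocalCoordinates

/-! ### The dual fields `ℓ_j` in a chart of the submanifold. -/

section SubmanifoldCoordinates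

variable {m n N : ℕ} {M : Type*} [TopologicalSpace M]
  [ChartedSpace (EuclideanSpace ℝ (Fin m)) M] [IsManifold (𝓡 m) ∞ M]
  {S : Type*} [TopologicalSpace S] [ChartedSpace (EuclideanSpace ℝ (Fin n)) S]
  [IsManifold (𝓡 n) ∞ S] [T2Space S]
  {η : PseudoRiemannianMetric m M}
  {φ : OpenPartialHomeomorph M (EuclideanSpace ℝ (Fin m))} {ι : S → M}

variable (η φ ι) in
/-- The vector field on the coordinate domain of the preferred chart of `S` at `q` which
represents the operator `D_j`. -/
def dLowerField (B : Bracket n S N) (ε : ℝ) (γ : S → ℝ) (q : S) (j : Fin m)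
    (u : EuclideanSpace ℝ (Fin n)) : EuclideanSpace ℝ (Fin n) :=
  WithLp.toLp 2 fun b ↦
    dLower η φ ι B ε γ j (fun q' ↦ extChartAt (𝓡 n) q q' b) ((extChartAt (𝓡 n) q).symm u)

variable {B : Bracket n S N} {ε : ℝ} {γ : S → ℝ} {q q' : S}

/-- The components of `dLowerField` are `D_j` of the chart coordinates, so it is the image of the
pointwise vector `L j` under the chart differential. Defining it this way, rather than through the
chosen `L j`, makes its differentiability accessible. -/
lemma dLowerField_spec (hι : ContMDiff (𝓡 n) (𝓡 m) ∞ ι)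
    (hg : ∀ (q : S) (v : TangentSpace (𝓡 n) q), (∀ w, inducedMetric η ι q v w = 0) → v = 0)
    (hφ : φ ∈ IsManifold.maximalAtlas (𝓡 m) ∞ M)
    (hε : ε = 1 ∨ ε = -1) (hγ : ∀ q, 0 < γ q) (hB : IsCompatible η φ ι B ε γ)
    (hq' : q' ∈ (extChartAt (𝓡 n) q).source) (hs : ι q' ∈ φ.source) :
    (∀ j f, SmoothNear n f q' → dLower η φ ι B ε γ j f q' =
      fderiv ℝ (f ∘ (extChartAt (𝓡 n) q).symm) (extChartAt (𝓡 n) q q')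
        (dLowerField η φ ι B ε γ q j (extChartAt (𝓡 n) q q'))) ∧
    ∀ w, ∑ j, fderiv ℝ (coordFun φ ι j ∘ (extChartAt (𝓡 n) q).symm) (extChartAt (𝓡 n) q q') w •
      dLowerField η φ ι B ε γ q j (extChartAt (𝓡 n) q q') = w := by
  obtain ⟨L, hL, hLY⟩ := exists_dual_tangentVectors hι (hg q') hφ hε (hγ q') hB hs
  have hcoord : ∀ b : Fin n, SmoothNear n (fun x ↦ extChartAt (𝓡 n) q x b) q' := by
    intro b
    filter_upwards [(isOpen_extChartAt_source (I := 𝓡 n) q).mem_nhds hq'] with x hx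
    have h : ContDiff ℝ ∞ fun u : EuclideanSpace ℝ (Fin n) ↦ u b := by fun_prop
    exact h.contMDiff.contMDiffAt.comp x (contMDiffAt_extChartAt' (by simpa using hx))
  have hfield : ∀ j, dLowerField η φ ι B ε γ q j (extChartAt (𝓡 n) q q') =
      mfderiv (𝓡 n) (𝓡 n) (extChartAt (𝓡 n) q) q' (L j) := by
    intro j
    refine PiLp.ext fun b ↦ ?_
    simp only [dLowerField, (extChartAt (𝓡 n) q).left_inv hq']
    rw [hL j _ (hcoord b), mvfderiv_eq_fderiv_comp_mfderiv hq' (hcoord b).contMDiffAt]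
    have h : ((fun x ↦ extChartAt (𝓡 n) q x b) ∘ (extChartAt (𝓡 n) q).symm) =ᶠ[
        𝓝 (extChartAt (𝓡 n) q q')] (EuclideanSpace.proj b : EuclideanSpace ℝ (Fin n) →L[ℝ] ℝ) := by
      filter_upwards [(isOpen_extChartAt_target (I := 𝓡 n) q).mem_nhds
        ((extChartAt (𝓡 n) q).map_source hq')] with u hu
      change ((extChartAt (𝓡 n) q) ((extChartAt (𝓡 n) q).symm u)).ofLp b = u.ofLp b
      rw [(extChartAt (𝓡 n) q).right_inv hu]
    rw [h.fderiv_eq, ContinuousLinearMap.fderiv]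
    rfl
  refine ⟨fun j f hf ↦ ?_, fun w ↦ ?_⟩
  · rw [hL j f hf, mvfderiv_eq_fderiv_comp_mfderiv hq' hf.contMDiffAt, hfield]
  -- The differential of the chart is onto, so duality for tangent vectors of `S` transfers to all
  -- of `ℝ^n`.
  · obtain ⟨Y, rfl⟩ : ∃ Y : TangentSpace (𝓡 n) q',
        mfderiv (𝓡 n) (𝓡 n) (extChartAt (𝓡 n) q) q' Y = w :=
      (isInvertible_mfderiv_extChartAt hq').surjective w
    conv_rhs => rw [← hLY Y]
    rw [map_sum]
    refine Finset.sum_congr rfl fun j _ ↦ ?_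
    rw [map_smul, hfield, ← mvfderiv_eq_fderiv_comp_mfderiv hq'
      (smoothNear_coordFun hι hφ hs j).contMDiffAt]
    rfl

lemma differentiableAt_dLowerField (hι : ContMDiff (𝓡 n) (𝓡 m) ∞ ι)
    (hφ : φ ∈ IsManifold.maximalAtlas (𝓡 m) ∞ M)
    (hγ : ∀ q, 0 < γ q) (hγs : ContMDiff (𝓡 n) 𝓘(ℝ) ∞ γ) (hq : ι q ∈ φ.source) (j : Fin m) :
    DifferentiableAt ℝ (dLowerField η φ ι B ε γ q j) (extChartAt (𝓡 n) q q) := by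
  rw [differentiableAt_euclidean]
  intro b
  have hs : SmoothNear n (fun x ↦ extChartAt (𝓡 n) q x b) q :=
    SmoothNear.comp_extChartAt (H := fun u ↦ u b) (by fun_prop) q
  exact (contMDiffAt_comp_extChartAt_symm (mem_extChartAt_source q)
    (smoothNear_dLower hι hφ hq hγ hγs hs j).contMDiffAt).differentiableAt (by simp)

end SubmanifoldCoordinates

end BracketGeometry

end

/-! ### Assembly: the commutator in the chart of `S` at `q`. -/

theorem mainTheorem3 {m n N : ℕ}
    {M : Type*} [TopologicalSpace M] [ChartedSpace (EuclideanSpace ℝ (Fin m)) M]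
    [IsManifold (𝓡 m) ∞ M]
    {S : Type*} [TopologicalSpace S] [T2Space S] [ChartedSpace (EuclideanSpace ℝ (Fin n)) S]
    [IsManifold (𝓡 n) ∞ S]
    (η : BracketGeometry.PseudoRiemannianMetric m M)
    (ι : S → M) (hι : Manifold.IsImmersion (𝓡 n) (𝓡 m) ∞ ι)
    (hg : ∀ (q : S) (v : TangentSpace (𝓡 n) q),
      (∀ w, BracketGeometry.inducedMetric η ι q v w = 0) → v = 0)
    (φ : OpenPartialHomeomorph M (EuclideanSpace ℝ (Fin m)))
    (hφ : φ ∈ IsManifold.maximalAtlas (𝓡 m) ∞ M)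
    (B : BracketGeometry.Bracket n S N)
    (ε : ℝ) (hε : ε = 1 ∨ ε = -1) (γ : C^∞⟮𝓡 n, S; ℝ⟯) (hγ : ∀ q, 0 < γ q)
    (hB : BracketGeometry.IsCompatible η φ ι B ε γ)
    (U : ∀ q : S, TangentSpace (𝓡 m) (ι q))
    (hU : ContMDiff (𝓡 n) (𝓡 m).tangent ∞ (fun q ↦ (⟨ι q, U q⟩ : TangentBundle (𝓡 m) M)))
    (q : S) (hq : ι q ∈ φ.source) (X Y : TangentSpace (𝓡 n) q) (k : Fin m) :
    ∑ i, ∑ j,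
        BracketGeometry.component φ i (ι q) (mfderiv (𝓡 n) (𝓡 m) ι q X) *
          BracketGeometry.component φ j (ι q) (mfderiv (𝓡 n) (𝓡 m) ι q Y) *
          (BracketGeometry.hatNablaSq η φ ι B ε γ U i j k q -
            BracketGeometry.hatNablaSq η φ ι B ε γ U j i k q) =
      ∑ l, ∑ i, ∑ j,
        BracketGeometry.curvature η φ k l i j (φ (ι q)) *
          BracketGeometry.component φ i (ι q) (mfderiv (𝓡 n) (𝓡 m) ι q X) *
          BracketGeometry.component φ j (ι q) (mfderiv (𝓡 n) (𝓡 m) ι q Y) *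
          BracketGeometry.component φ l (ι q) (U q) := by
  have hιs : ContMDiff (𝓡 n) (𝓡 m) ∞ ι := hι.contMDiff
  have hγs : ContMDiff (𝓡 n) 𝓘(ℝ) ∞ γ := γ.contMDiff
  let ψ := extChartAt (𝓡 n) q
  have hqs : q ∈ ψ.source := mem_extChartAt_source q
  have hψq : ψ.symm (ψ q) = q := extChartAt_to_inv q
  let x : Fin m → EuclideanSpace ℝ (Fin n) → ℝ := fun l ↦
    BracketGeometry.coordFun φ ι l ∘ ψ.symm
  let g : Fin m → Fin m → Fin m → EuclideanSpace ℝ (Fin n) → ℝ := fun k l r u ↦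
    BracketGeometry.christoffel η φ k l r (φ (ι (ψ.symm u)))
  let V : Fin m → S → ℝ := fun k q' ↦ BracketGeometry.component φ k (ι q') (U q')
  let ℓ := BracketGeometry.dLowerField η φ ι B ε γ q
  let T : Fin m → Fin m → S → ℝ := BracketGeometry.hatNabla η φ ι B ε γ V
  have hxs := fun l ↦ BracketGeometry.smoothNear_coordFun hιs hφ hq l
  have hVs : ∀ k, BracketGeometry.SmoothNear n (V k) q := fun k ↦
    BracketGeometry.smoothNear_component hφ hιs.continuous hU hq k
  have hgs : ∀ k l r, BracketGeometry.SmoothNear n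
      (fun q' ↦ BracketGeometry.christoffel η φ k l r (φ (ι q'))) q := fun k l r ↦
    BracketGeometry.smoothNear_chart_comp hιs hφ hq fun _ hz ↦
      BracketGeometry.contDiffAt_christoffel hφ hz k l r
  have hTs : ∀ j k, BracketGeometry.SmoothNear n (T j k) q := fun j k ↦
    BracketGeometry.smoothNear_hatNabla hιs hφ hq hγ hγs hVs j k
  have hcont : ContinuousAt ψ.symm (ψ q) := continuousAt_extChartAt_symm q
  have hev : ∀ P : S → Prop, (∀ᶠ q' in 𝓝 q, P q') → ∀ᶠ u in 𝓝 (ψ q), P (ψ.symm u) := by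
    intro P hP
    refine hcont.eventually ?_
    rwa [hψq]
  -- Representation and duality hold near `ψ q`, where points stay both in the chart of `S` and over
  -- the domain of `φ`.
  have hspec : ∀ᶠ u in 𝓝 (ψ q), (∀ j f, BracketGeometry.SmoothNear n f (ψ.symm u) →
      BracketGeometry.dLower η φ ι B ε γ j f (ψ.symm u) = fderiv ℝ (f ∘ ψ.symm) u (ℓ j u)) ∧
      ∀ w, ∑ j, fderiv ℝ (x j) u w • ℓ j u = w := by
    filter_upwards [extChartAt_target_mem_nhds (I := 𝓡 n) q,
      hev _ (BracketGeometry.eventually_mem_source hιs hq)] with u hu hus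
    have h := BracketGeometry.dLowerField_spec hιs hg hφ hε hγ hB (ψ.map_target hu) hus
    rwa [show extChartAt (𝓡 n) q (ψ.symm u) = u from ψ.right_inv hu] at h
  have h2 : ∀ {f : S → ℝ}, BracketGeometry.SmoothNear n f q →
      ContDiffAt ℝ 2 (f ∘ ψ.symm) (ψ q) := fun hf ↦
    (BracketGeometry.contMDiffAt_comp_extChartAt_symm hqs hf.contMDiffAt).of_le
      (WithTop.coe_le_coe.2 (le_top : (2 : ℕ∞) ≤ ⊤))
  have hgd : ∀ k l r, DifferentiableAt ℝ (g k l r) (ψ q) := fun k l r ↦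
    (h2 (hgs k l r)).differentiableAt two_ne_zero
  have hT : ∀ j k, T j k ∘ ψ.symm =ᶠ[𝓝 (ψ q)] fun u ↦
      BracketGeometry.pullbackNabla x g (fun k ↦ V k ∘ ψ.symm) k u (ℓ j u) := by
    intro j k
    filter_upwards [hspec, hev _ (hVs k).eventually,
      Filter.eventually_all.2 fun l ↦ hev _ (hxs l).eventually] with u hu hVu hxu
    rw [BracketGeometry.pullbackNabla_apply]
    simp only [T, Function.comp, BracketGeometry.hatNabla, BracketGeometry.dMixed]
    rw [hu.1 j _ hVu]
    simp only [fun l ↦ hu.1 j _ (hxu l)]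
    rfl
  have hQ : ∀ i j k, BracketGeometry.hatNablaSq η φ ι B ε γ U i j k q =
      fderiv ℝ (T j k ∘ ψ.symm) (ψ q) (ℓ i (ψ q)) +
        ∑ l, ∑ r, fderiv ℝ (x l) (ψ q) (ℓ i (ψ q)) *
          (g k l r (ψ q) * (T j r ∘ ψ.symm) (ψ q) - g r l j (ψ q) * (T r k ∘ ψ.symm) (ψ q)) := by
    intro i j k
    have h := hspec.self_of_nhds.1
    rw [hψq] at h
    rw [BracketGeometry.hatNablaSq, BracketGeometry.hatNablaTensor, h i _ (hTs j k)]
    simp only [BracketGeometry.dMixed, fun l ↦ h i _ (hxs l), g, Function.comp, hψq]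
    rfl
  have hcomp : ∀ i (Z : TangentSpace (𝓡 n) q),
      BracketGeometry.component φ i (ι q) (mfderiv (𝓡 n) (𝓡 m) ι q Z) =
        fderiv ℝ (x i) (ψ q) Z := by
    intro i Z
    rw [← BracketGeometry.mvfderiv_coordFun hιs hφ hq,
      BracketGeometry.mvfderiv_eq_fderiv_extChartAt
        ((hxs i).contMDiffAt.mdifferentiableAt (by simp))]
    rfl
  have hgX : ∀ k l r (Z : EuclideanSpace ℝ (Fin n)), fderiv ℝ (g k l r) (ψ q) Z =
      ∑ i, BracketGeometry.partialDeriv i (BracketGeometry.christoffel η φ k l r) (φ (ι q)) *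
        fderiv ℝ (x i) (ψ q) Z := fun k l r Z ↦
    BracketGeometry.fderiv_comp_chart hιs hφ hq
      ((BracketGeometry.contDiffAt_christoffel hφ (φ.map_source hq) k l r).differentiableAt
        (by simp)) Z
  -- `TangentSpace (𝓡 n) q` unfolds to the model space, so `X` and `Y` become constant vectors in
  -- the chart.
  suffices H : ∀ X Y : EuclideanSpace ℝ (Fin n),
      ∑ i, ∑ j, fderiv ℝ (x i) (ψ q) X * fderiv ℝ (x j) (ψ q) Y *
        (BracketGeometry.hatNablaSq η φ ι B ε γ U i j k q -
          BracketGeometry.hatNablaSq η φ ι B ε γ U j i k q) =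
      ∑ l, ∑ i, ∑ j, BracketGeometry.curvature η φ k l i j (φ (ι q)) *
        fderiv ℝ (x i) (ψ q) X * fderiv ℝ (x j) (ψ q) Y *
          BracketGeometry.component φ l (ι q) (U q) by
    simp only [hcomp]
    exact H X Y
  intro X Y
  refine (BracketGeometry.hatNabla_commutator (fun l ↦ h2 (hxs l)) (fun k ↦ h2 (hVs k)) hgd
    (fun k l r ↦ by simp only [g, BracketGeometry.christoffel_comm k l r])
    (fun j ↦ BracketGeometry.differentiableAt_dLowerField hιs hφ hγ hγs hq j)
    (hspec.mono fun u hu ↦ hu.2) hT hQ X Y k).trans ?_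
  refine Finset.sum_congr rfl fun l _ ↦ ?_
  have hV : (V l ∘ ψ.symm) (ψ q) = BracketGeometry.component φ l (ι q) (U q) := by
    simp only [Function.comp, hψq, V]
  have hgq : ∀ a b c, g a b c (ψ q) = BracketGeometry.christoffel η φ a b c (φ (ι q)) := by
    intro a b c
    simp only [g, hψq]
  rw [hV]
  change (∑ j, fderiv ℝ (x j) (ψ q) Y * fderiv ℝ (g k j l) (ψ q) X -
    ∑ i, fderiv ℝ (x i) (ψ q) X * fderiv ℝ (g k i l) (ψ q) Y +
    ∑ i, ∑ j, (∑ r, (g k i r (ψ q) * g r j l (ψ q) - g k j r (ψ q) * g r i l (ψ q))) *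
      fderiv ℝ (x i) (ψ q) X * fderiv ℝ (x j) (ψ q) Y) * _ = _
  simp only [hgX, hgq, BracketGeometry.curvature, ← Finset.sum_mul]
  congr 1
  -- By the chain rule `hgX`, `e1` and `e2` are the two `∂Γ` terms of the curvature contracted with
  -- `X` and `Y`.
  have e1 : ∑ j, fderiv ℝ (x j) (ψ q) Y * ∑ i, BracketGeometry.partialDeriv i
        (BracketGeometry.christoffel η φ k j l) (φ (ι q)) * fderiv ℝ (x i) (ψ q) X =
      ∑ i, ∑ j, BracketGeometry.partialDeriv i (BracketGeometry.christoffel η φ k j l) (φ (ι q)) *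
        fderiv ℝ (x i) (ψ q) X * fderiv ℝ (x j) (ψ q) Y := by
    rw [Finset.sum_comm]
    refine Finset.sum_congr rfl fun j _ ↦ ?_
    rw [Finset.mul_sum]
    exact Finset.sum_congr rfl fun i _ ↦ by ring
  have e2 : ∑ i, fderiv ℝ (x i) (ψ q) X * ∑ j, BracketGeometry.partialDeriv j
        (BracketGeometry.christoffel η φ k i l) (φ (ι q)) * fderiv ℝ (x j) (ψ q) Y =
      ∑ i, ∑ j, BracketGeometry.partialDeriv j (BracketGeometry.christoffel η φ k i l) (φ (ι q)) *
        fderiv ℝ (x i) (ψ q) X * fderiv ℝ (x j) (ψ q) Y := by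
    refine Finset.sum_congr rfl fun i _ ↦ ?_
    rw [Finset.mul_sum]
    exact Finset.sum_congr rfl fun j _ ↦ by ring
  rw [e1, e2, ← Finset.sum_sub_distrib, ← Finset.sum_add_distrib]
  refine Finset.sum_congr rfl fun i _ ↦ ?_
  rw [← Finset.sum_sub_distrib, ← Finset.sum_add_distrib]
  exact Finset.sum_congr rfl fun j _ ↦ by ring
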